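/- Setting. Let $f:\mathbb R^n\to\mathbb R$ be differentiable, $L$-smooth ($\|\nabla f(x)-\nabla f(y)\|_2\le L\|x-y\|_2$) and $\mu$-strongly convex ($f(x)\ge f(y)+\langle\nabla f(y),x-y\rangle+\frac{\mu}{2}\|x-y\|_2^2$), where $L,\mu>0$, and let $x^*$ be a minimizer of $f$. The function is accessible through stochastic gradients $\nabla f(x,\xi)$ with $\mathbb E_\xi[\nabla f(x,\xi)]=\nabla f(x)$ and $\mathbb E_\xi\|\nabla f(x,\xi)-\nabla f(x)\|_2^2\le\sigma^2$ for all $x$. clipped-SSTM with starting point $x^0$, $N$ iterations, batchsizes $m_k$, stepsize parameter $a$ and clipping parameter $B$: put $A_0=0$, $y^0=z^0=x^0$, and for $k=0,\dots,N-1$ $$\alpha_{k+1}=\tfrac{k+2}{2aL},\quad A_{k+1}=A_k+\alpha_{k+1},\quad \lambda_{k+1}=\tfrac{B}{\alpha_{k+1}},\quad x^{k+1}=\tfrac{A_ky^k+\alpha_{k+1}z^k}{A_{k+1}},$$ $$g^{k}=\tfrac1{m_k}\sum_{i=1}^{m_k}\nabla f(x^{k+1},\xi_i^k),\quad z^{k+1}=z^k-\alpha_{k+1}\min\{1,\lambda_{k+1}/\|g^k\|_2\}\,g^k,\quad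 y^{k+1}=\tfrac{A_ky^k+\alpha_{k+1}z^{k+1}}{A_{k+1}},$$ with fresh i.i.d. samples $\xi_i^k$; the output is $y^N$. R-clipped-SSTM sets $\hat x^0=x^0$ and, for $t=0,1,\dots,\tau-1$, lets $\hat x^{t+1}$ be the output of clipped-SSTM run for $N_0$ iterations from $\hat x^t$ with batchsizes $m^t_k$, stepsize parameter $a$ and clipping parameter $B_t$. Let $\varepsilon>0$, $\beta\in(0,1)$, $N_0\ge1$, $C=\sqrt5$, $R=\sqrt{2(f(x^0)-f(x^*))/\mu}$, $\tau=\max\{0,\lceil\log_2\frac{\mu R^2}{2\varepsilon}\rceil\}$ (with $\tau=0$ if $R=0$), and suppose that, with $\ell=\ln\frac{4N_0\tau}{\beta}$ (so that $\tau\ge1$), $$\ell\ge2,\qquad N_0\ge C\sqrt{\tfrac{8aL}{\mu}},\qquad a\ge\max\Big\{1,\tfrac{16\ell}{C},36\big(2\ell+\sqrt{4\ell^2+2\ell}\big)^2\Big\},$$ $$m_k^t=\Big\lceil\max\Big\{1,\tfrac{6000\cdot2^t\sigma^2\alpha_{k+1}^2N_0\ell}{C^2R^2},\tfrac{10368\cdot2^t\sigma^2\alpha_{k+1}^2N_0}{C^2R^2}\Big\}\Big\rceil,\qquad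 B_t=\frac{CR}{8\cdot2^{t/2}\,\ell},$$ and that $$a=\Theta\Big(\frac{\sigma^4\ln^2\frac{N_0\tau}{\beta}}{L\mu\varepsilon^2}\Big),\qquad N_0=\Theta\Big(\sqrt{\tfrac{aL}{\mu}}\Big).$$ Statement. After $\tau$ runs of clipped-SSTM in R-clipped-SSTM, $f(\hat x^\tau)-f(x^*)\le\varepsilon$ holds with probability at least $1-\beta$. Moreover, the total number $N_0\tau$ of iterations of clipped-SSTM is $$O\Big(\frac{\sigma^2}{\mu\varepsilon}\,\ln\Big(\frac{\mu R^2}{\varepsilon}\Big)\,\max\Big\{1,\ln\Big(\frac{\sigma^2}{\mu\varepsilon\beta}\ln\frac{\mu R^2}{\varepsilon}\Big)\Big\}\Big),$$ and $m_k^t=O(1)$ for all $0\le k<N_0$, $0\le t<\tau$. The constants hidden in these $O(\cdot)$ depend only on the constants in the two $\Theta(\cdot)$ conditions (which may be arbitrary positive numbers), and not on $n$, $f$, $x^0$, the distribution of the noise, or any of the parameters $L,\mu,\sigma,\varepsilon,\beta,a,N_0$. -/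

import Mathlib

open MeasureTheory ProbabilityTheory

namespace ClippedSSTM

/-- `f` is `L`-smooth on `ℝⁿ`: differentiable with `L`-Lipschitz gradient. -/
def IsLSmooth {n : ℕ} (f : EuclideanSpace ℝ (Fin n) → ℝ) (L : ℝ) : Prop :=
  Differentiable ℝ f ∧ ∀ x y, ‖gradient f x - gradient f y‖ ≤ L * ‖x - y‖

/-- The differentiable function `f` is `μ`-strongly convex on `ℝⁿ`. -/
def IsStronglyConvex {n : ℕ} (f : EuclideanSpace ℝ (Fin n) → ℝ) (μ : ℝ) : Prop :=
  Differentiable ℝ f ∧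
    ∀ x y, f y + inner ℝ (gradient f y) (x - y) + μ / 2 * ‖x - y‖ ^ 2 ≤ f x

/-- `G x s` (the stochastic gradient at `x` for the sample `s`, where `s` has law `D`) is an
unbiased estimator of `∇ f x` with variance at most `σ ^ 2`, at every point `x`. -/
structure IsStochasticGradient {n : ℕ} {S : Type*} [MeasurableSpace S]
    (f : EuclideanSpace ℝ (Fin n) → ℝ)
    (G : EuclideanSpace ℝ (Fin n) → S → EuclideanSpace ℝ (Fin n))
    (D : Measure S) (σ : ℝ) : Prop where
  measurable : Measurable (Function.uncurry G)
  integrable : ∀ x, Integrable (G x) D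
  unbiased : ∀ x, ∫ s, G x s ∂D = gradient f x
  integrable_sq : ∀ x, Integrable (fun s => ‖G x s - gradient f x‖ ^ 2) D
  variance_le : ∀ x, ∫ s, ‖G x s - gradient f x‖ ^ 2 ∂D ≤ σ ^ 2

/-- The clipping operator `min {1, l / ‖g‖} g`. -/
noncomputable def clip {n : ℕ} (g : EuclideanSpace ℝ (Fin n)) (l : ℝ) :
    EuclideanSpace ℝ (Fin n) :=
  min 1 (l / ‖g‖) • g

/-- The mini-batched stochastic gradient over the samples `s 0, …, s (m - 1)`. -/
noncomputable def miniBatch {n : ℕ} {S : Type*}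
    (G : EuclideanSpace ℝ (Fin n) → S → EuclideanSpace ℝ (Fin n))
    (m : ℕ) (s : ℕ → S) (x : EuclideanSpace ℝ (Fin n)) : EuclideanSpace ℝ (Fin n) :=
  (m : ℝ)⁻¹ • ∑ i ∈ Finset.range m, G x (s i)

/-- `α₀ = 0` and `α_{k+1} = (k + 2) / (2 a L)`. -/
noncomputable def alpha (a L : ℝ) : ℕ → ℝ
  | 0 => 0
  | k + 1 => ((k : ℝ) + 2) / (2 * a * L)

/-- `A₀ = 0` and `A_{k+1} = A_k + α_{k+1}`. -/
noncomputable def bigA (a L : ℝ) : ℕ → ℝ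
  | 0 => 0
  | k + 1 => bigA a L k + alpha a L (k + 1)

/-- The point `x^{k+1} = (A_k y^k + α_{k+1} z^k) / A_{k+1}`. -/
noncomputable def xPoint {n : ℕ} (a L : ℝ) (k : ℕ) (y z : EuclideanSpace ℝ (Fin n)) :
    EuclideanSpace ℝ (Fin n) :=
  (bigA a L (k + 1))⁻¹ • (bigA a L k • y + alpha a L (k + 1) • z)

/-- The iterates `(y^k, z^k)` of clipped-SSTM from the starting point `x0`, with batchsizes `m k`,
stepsize parameter `a` and clipping parameter `B` (so `λ_{k+1} = B / α_{k+1}`), where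
`s k 0, s k 1, …` are the samples available at iteration `k`. -/
noncomputable def iter {n : ℕ} {S : Type*}
    (G : EuclideanSpace ℝ (Fin n) → S → EuclideanSpace ℝ (Fin n))
    (L a B : ℝ) (m : ℕ → ℕ) (s : ℕ → ℕ → S) (x0 : EuclideanSpace ℝ (Fin n)) :
    ℕ → EuclideanSpace ℝ (Fin n) × EuclideanSpace ℝ (Fin n)
  | 0 => (x0, x0)
  | k + 1 =>
    let y := (iter G L a B m s x0 k).1
    let z := (iter G L a B m s x0 k).2
    let x := xPoint a L k y z
    let g := clip (miniBatch G (m k) (s k) x) (B / alpha a L (k + 1))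
    let z' := z - alpha a L (k + 1) • g
    ((bigA a L (k + 1))⁻¹ • (bigA a L k • y + alpha a L (k + 1) • z'), z')

/-- The points `x̂^t` of R-clipped-SSTM: run `t` of clipped-SSTM makes `N₀` iterations from `x̂^t`
with batchsizes `m t`, clipping parameter `B t` and samples `s t`; its output is `x̂^{t+1}`. -/
noncomputable def restarted {n : ℕ} {S : Type*}
    (G : EuclideanSpace ℝ (Fin n) → S → EuclideanSpace ℝ (Fin n))
    (L a : ℝ) (N₀ : ℕ) (B : ℕ → ℝ) (m : ℕ → ℕ → ℕ) (s : ℕ → ℕ → ℕ → S)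
    (x0 : EuclideanSpace ℝ (Fin n)) : ℕ → EuclideanSpace ℝ (Fin n)
  | 0 => x0
  | t + 1 => (iter G L a (B t) (m t) (s t) (restarted G L a N₀ B m s x0 t) N₀).1

/-- The logarithm `ln (4 N₀ τ / β)`. -/
noncomputable def logFactor (N₀ τ : ℕ) (β : ℝ) : ℝ :=
  Real.log (4 * N₀ * τ / β)

/-- The constant `C = √5`. -/
noncomputable def constC : ℝ := √5

/-- The batchsize `m_k^t`, rounded up to an integer. -/
noncomputable def batchSize (L σ β R a : ℝ) (N₀ τ t k : ℕ) : ℕ :=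
  ⌈max 1 (max
    (6000 * 2 ^ t * σ ^ 2 * alpha a L (k + 1) ^ 2 * N₀ * logFactor N₀ τ β / (constC ^ 2 * R ^ 2))
    (10368 * 2 ^ t * σ ^ 2 * alpha a L (k + 1) ^ 2 * N₀ / (constC ^ 2 * R ^ 2)))⌉₊

/-- The clipping parameter `B_t` of run `t`. -/
noncomputable def clipParam (β R : ℝ) (N₀ τ t : ℕ) : ℝ :=
  constC * R / (8 * (2 : ℝ) ^ ((t : ℝ) / 2) * logFactor N₀ τ β)

/-- The lower bound imposed on the stepsize parameter `a`. -/
noncomputable def aLowerBound (β : ℝ) (N₀ τ : ℕ) : ℝ :=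
  max 1 (max (16 * logFactor N₀ τ β / constC)
    (36 * (2 * logFactor N₀ τ β
      + √(4 * logFactor N₀ τ β ^ 2 + 2 * logFactor N₀ τ β)) ^ 2))

end ClippedSSTM

namespace ClippedSSTM

/-! Write `ρ` for the radius of a run and `ℓ` for the logarithmic factor. A step changes the
potential `A_k (f y^k - f x*) + ‖z^k - x*‖² / 2` by at most an explicit error `stepError`, which
vanishes when the clipped gradient is exact (`potential_step`). A run starts with potential at most
`ρ² / 10`. While the accumulated errors stay below `2ρ² / 5`, the potential stays below `ρ² / 2`.
Hence `z^k` and `y^k` remain in the `ρ`-ball, and the lower bound on `a` keeps the true gradient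
below half the clipping level (`gradient_xPoint_le`). Since `A_N` grows like `N² / (4aL)`, such a
run halves the gap, and `τ` runs reach `ε`.

The errors are controlled by an exponential-moment argument. Each error is replaced by zero when the
current state is outside the good region, so that its moment bound holds for every state and no
conditioning on success is needed. In the good region clipping makes `4ℓ / ρ²` times the error at
most `1` in absolute value, so `exp u ≤ 1 + u + u²` applies. The unclipped noise has mean zero,
while the clipping bias and the quadratic terms are of the order of the minibatch variance
(`exp_stepError_le`). Independence of fresh samples multiplies these bounds
(`lintegral_exp_errorSum_le`). Markov's inequality and a union bound over iterations and runs give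
failure probability at most `N₀ τ exp (-ℓ) = β / 4`. On the complement, an induction shows that the
truncated errors are the true ones (`potential_le_of_errorSum_le`).

For the complexity, the upper bounds on `a` and `N₀` bound `N₀` by a multiple of `σ² / (με)` times
`Λ = log (N₀ τ / β)`. As `N₀` also occurs inside `Λ`, the estimate is closed by
`le_two_mul_log_of_exp_le`. The batchsizes are bounded because the powers of `N₀` and `a` cancel
(`batchSize_le`). -/

/-! ### Consequences of smoothness and strong convexity -/

/-- Along the segment, `f` minus its claimed quadratic upper model has nonpositive derivative, by
Cauchy–Schwarz and the Lipschitz bound. Monotonicity then replaces an integral of the gradient. -/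
lemma IsLSmooth.descent {n : ℕ} {f : EuclideanSpace ℝ (Fin n) → ℝ} {L : ℝ}
    (hf : IsLSmooth f L) (x y : EuclideanSpace ℝ (Fin n)) :
    f y ≤ f x + inner ℝ (gradient f x) (y - x) + L / 2 * ‖y - x‖ ^ 2 := by
  set v := y - x with hv
  set φ : ℝ → ℝ := fun r => f (x + r • v) - r * inner ℝ (gradient f x) v - L / 2 * r ^ 2 * ‖v‖ ^ 2
    with hφ
  have hd : ∀ r, HasDerivAt φ (inner ℝ (gradient f (x + r • v)) v - inner ℝ (gradient f x) v
      - L * r * ‖v‖ ^ 2) r := by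
    intro r
    have h1 : HasDerivAt (fun r : ℝ => x + r • v) v r := by
      simpa using ((hasDerivAt_id r).smul_const v).const_add x
    have h2 := (hf.1 (x + r • v)).hasFDerivAt.comp_hasDerivAt r h1
    rw [← inner_gradient_left] at h2
    have h3 := (h2.sub ((hasDerivAt_id r).mul_const (inner ℝ (gradient f x) v))).sub
      ((((hasDerivAt_id r).pow 2).const_mul (L / 2)).mul_const (‖v‖ ^ 2))
    refine (h3.congr_deriv ?_).congr_of_eventuallyEq (.of_forall fun r => ?_)
    · simp only [id, Nat.cast_ofNat]; ring
    · simp [hφ]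
  have hanti : AntitoneOn φ (Set.Icc 0 1) := by
    refine antitoneOn_of_deriv_nonpos (convex_Icc 0 1)
      (fun r _ => (hd r).continuousAt.continuousWithinAt)
      (fun r _ => (hd r).differentiableAt.differentiableWithinAt) ?_
    intro r hr
    rw [interior_Icc] at hr
    rw [(hd r).deriv, ← inner_sub_left]
    have h1 := real_inner_le_norm (gradient f (x + r • v) - gradient f x) v
    have h2 := hf.2 (x + r • v) x
    rw [add_sub_cancel_left, norm_smul, Real.norm_of_nonneg hr.1.le] at h2
    have h3 := mul_le_mul_of_nonneg_right h2 (norm_nonneg v)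
    nlinarith
  have h := hanti (by simp) (by simp) zero_le_one
  simp only [hφ] at h
  simp only [one_smul, zero_smul, add_zero] at h
  have hxy : x + v = y := by simp [hv]
  rw [hxy] at h
  linarith

/-- A gradient step of length `1 / L` decreases `f` by at least `‖∇f‖² / (2L)`, yet cannot go below
`fmin`. -/
lemma IsLSmooth.sq_norm_gradient_le {n : ℕ} {f : EuclideanSpace ℝ (Fin n) → ℝ} {L fmin : ℝ}
    (hf : IsLSmooth f L) (hL : 0 < L) (hmin : ∀ x, fmin ≤ f x) (x : EuclideanSpace ℝ (Fin n)) :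
    ‖gradient f x‖ ^ 2 ≤ 2 * L * (f x - fmin) := by
  have h := hf.descent x (x - L⁻¹ • gradient f x)
  have h2 := hmin (x - L⁻¹ • gradient f x)
  rw [sub_sub_cancel_left, inner_neg_right, inner_smul_right, norm_neg, norm_smul,
    real_inner_self_eq_norm_sq, Real.norm_of_nonneg (inv_nonneg.2 hL.le)] at h
  have h3 : L / 2 * (L⁻¹ * ‖gradient f x‖) ^ 2 = L⁻¹ * ‖gradient f x‖ ^ 2 / 2 := by
    field_simp
  have h4 : L⁻¹ * ‖gradient f x‖ ^ 2 ≤ 2 * (f x - fmin) := by linarith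
  calc ‖gradient f x‖ ^ 2 = L * (L⁻¹ * ‖gradient f x‖ ^ 2) := by field_simp
    _ ≤ L * (2 * (f x - fmin)) := by gcongr
    _ = _ := by ring

lemma IsLSmooth.continuous_gradient {n : ℕ} {f : EuclideanSpace ℝ (Fin n) → ℝ} {L : ℝ}
    (hf : IsLSmooth f L) (hL : 0 < L) : Continuous (gradient f) := by
  refine (LipschitzWith.of_dist_le_mul (K := ⟨L, hL.le⟩) fun x y => ?_).continuous
  rw [dist_eq_norm, dist_eq_norm]
  exact hf.2 x y

lemma gradient_eq_zero_of_forall_le {n : ℕ} {f : EuclideanSpace ℝ (Fin n) → ℝ}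
    {x : EuclideanSpace ℝ (Fin n)} (hmin : ∀ y, f x ≤ f y) : gradient f x = 0 := by
  have h : IsLocalMin f x := Filter.Eventually.of_forall hmin
  simp [gradient, h.fderiv_eq_zero]

lemma IsStronglyConvex.sq_norm_sub_le {n : ℕ} {f : EuclideanSpace ℝ (Fin n) → ℝ} {μ : ℝ}
    (hf : IsStronglyConvex f μ) {xstar : EuclideanSpace ℝ (Fin n)} (hmin : ∀ y, f xstar ≤ f y)
    (x : EuclideanSpace ℝ (Fin n)) : μ / 2 * ‖x - xstar‖ ^ 2 ≤ f x - f xstar := by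
  have h := hf.2 x xstar
  rw [gradient_eq_zero_of_forall_le hmin, inner_zero_left] at h
  linarith

/-! ### The clipping operator -/

lemma norm_clip_le {n : ℕ} (g : EuclideanSpace ℝ (Fin n)) {l : ℝ} (hl : 0 ≤ l) :
    ‖clip g l‖ ≤ l := by
  have h0 : 0 ≤ min 1 (l / ‖g‖) := le_min zero_le_one (by positivity)
  rw [clip, norm_smul, Real.norm_of_nonneg h0]
  rcases (norm_nonneg g).eq_or_lt' with h | h
  · simp [h, hl]
  · calc min 1 (l / ‖g‖) * ‖g‖ ≤ l / ‖g‖ * ‖g‖ := by gcongr; exact min_le_right _ _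
      _ = l := by field_simp

lemma clip_of_norm_le {n : ℕ} {g : EuclideanSpace ℝ (Fin n)} {l : ℝ} (h : ‖g‖ ≤ l) :
    clip g l = g := by
  rcases (norm_nonneg g).eq_or_lt' with h0 | h0
  · rw [clip, norm_eq_zero.1 h0, smul_zero]
  · rw [clip, min_eq_left ((one_le_div h0).2 h), one_smul]

lemma clip_of_le_norm {n : ℕ} {g : EuclideanSpace ℝ (Fin n)} {l : ℝ} (hl : 0 < l)
    (h : l ≤ ‖g‖) : clip g l = (l / ‖g‖) • g := by
  rw [clip, min_eq_right ((div_le_one (hl.trans_le h)).2 h)]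

/-- Clipping is projection onto the ball of radius `l`, so it does not increase the distance to a
point `v` of that ball. With `c = l / ‖g‖` the squared distance drops by `(1 - c) ((1 + c) ‖g‖² -
2⟨g, v⟩)`. -/
lemma norm_clip_sub_le {n : ℕ} (g : EuclideanSpace ℝ (Fin n)) {v : EuclideanSpace ℝ (Fin n)}
    {l : ℝ} (hl : 0 < l) (hv : ‖v‖ ≤ l / 2) : ‖clip g l - v‖ ≤ ‖g - v‖ := by
  rcases le_total ‖g‖ l with h | h
  · rw [clip_of_norm_le h]
  · rw [clip_of_le_norm hl h]
    have hg : 0 < ‖g‖ := hl.trans_le h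
    set c := l / ‖g‖ with hc
    have hcg : c * ‖g‖ = l := by rw [hc]; field_simp
    have hc0 : 0 < c := by positivity
    have hc1 : c ≤ 1 := (div_le_one hg).2 h
    refine le_of_sq_le_sq ?_ (norm_nonneg _)
    rw [norm_sub_sq_real, norm_sub_sq_real, norm_smul, inner_smul_left,
      Real.norm_of_nonneg hc0.le]
    have hin := real_inner_le_norm g v
    simp only [conj_trivial]
    have h1 : inner ℝ g v ≤ ‖g‖ * (l / 2) := hin.trans (by gcongr)
    have h2 : 0 ≤ (1 - c) * ((1 + c) * ‖g‖ ^ 2 - 2 * inner ℝ g v) := by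
      refine mul_nonneg (by linarith) ?_
      nlinarith
    nlinarith

/-- Clipping acts only if `‖g‖ > l`, and then `‖g - v‖ ≥ ‖g‖ - l / 2`; completing a square compares
`‖g‖ - l` with the square of this. The bias of clipping is thereby bounded by a variance, not just a
standard deviation. -/
lemma norm_sub_clip_le {n : ℕ} (g : EuclideanSpace ℝ (Fin n)) {v : EuclideanSpace ℝ (Fin n)}
    {l : ℝ} (hl : 0 < l) (hv : ‖v‖ ≤ l / 2) : ‖clip g l - g‖ ≤ ‖g - v‖ ^ 2 / (2 * l) := by
  rcases le_total ‖g‖ l with h | h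
  · rw [clip_of_norm_le h, sub_self, norm_zero]; positivity
  · have hg : 0 < ‖g‖ := hl.trans_le h
    have h1 : ‖clip g l - g‖ = ‖g‖ - l := by
      have : clip g l - g = (l / ‖g‖ - 1) • g := by rw [clip_of_le_norm hl h, sub_smul, one_smul]
      rw [this, norm_smul, Real.norm_of_nonpos (by linarith [(div_le_one hg).2 h])]
      field_simp
      ring
    have h2 : ‖g‖ - l / 2 ≤ ‖g - v‖ := by linarith [norm_sub_norm_le g v]
    rw [h1, le_div_iff₀ (by positivity)]
    have h3 : (‖g‖ - l / 2) ^ 2 ≤ ‖g - v‖ ^ 2 := by gcongr; linarith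
    nlinarith [sq_nonneg (‖g‖ - l / 2 - l)]

/-! ### The stepsizes -/

lemma alpha_succ (a L : ℝ) (k : ℕ) : alpha a L (k + 1) = ((k : ℝ) + 2) / (2 * a * L) := rfl

lemma alpha_succ_pos {a L : ℝ} (ha : 0 < a) (hL : 0 < L) (k : ℕ) : 0 < alpha a L (k + 1) := by
  rw [alpha_succ]; positivity

lemma bigA_eq {a L : ℝ} (ha : 0 < a) (hL : 0 < L) (k : ℕ) :
    bigA a L k = k * (k + 3) / (4 * a * L) := by
  induction k with
  | zero => simp [bigA]
  | succ k ih =>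
    rw [bigA, ih, alpha_succ]
    push_cast
    field_simp
    ring

lemma bigA_nonneg {a L : ℝ} (ha : 0 < a) (hL : 0 < L) (k : ℕ) : 0 ≤ bigA a L k := by
  rw [bigA_eq ha hL]; positivity

lemma bigA_succ_pos {a L : ℝ} (ha : 0 < a) (hL : 0 < L) (k : ℕ) : 0 < bigA a L (k + 1) :=
  add_pos_of_nonneg_of_pos (bigA_nonneg ha hL k) (alpha_succ_pos ha hL k)

/-- This is the stepsize condition that absorbs the quadratic term of the descent inequality in
`potential_step`. It reduces to `(k + 2)² ≤ (k + 1)(k + 4)` and `a ≥ 1`. -/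
lemma sq_alpha_mul_le {a L : ℝ} (ha : 1 ≤ a) (hL : 0 < L) (k : ℕ) :
    L * alpha a L (k + 1) ^ 2 ≤ bigA a L (k + 1) := by
  have ha0 : 0 < a := by linarith
  rw [bigA_eq ha0 hL, alpha_succ, div_pow, ← mul_div_assoc,
    div_le_div_iff₀ (by positivity) (by positivity)]
  push_cast
  have h : ((k : ℝ) + 2) ^ 2 ≤ (k + 1) * (k + 1 + 3) * a := by
    calc ((k : ℝ) + 2) ^ 2 ≤ (k + 1) * (k + 1 + 3) * 1 := by nlinarith [k.cast_nonneg (α := ℝ)]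
      _ ≤ _ := by gcongr
  calc L * ((k : ℝ) + 2) ^ 2 * (4 * a * L) = 4 * a * L ^ 2 * ((k : ℝ) + 2) ^ 2 := by ring
    _ ≤ 4 * a * L ^ 2 * ((k + 1) * (k + 1 + 3) * a) := by gcongr
    _ = _ := by ring

/-! ### One step of the method -/

/-- The change of the potential `A (f y - f xstar) + ‖z - xstar‖ ^ 2 / 2` caused by the error
`θ` of the gradient estimate in a step of length `α` from `z`, where `v` is the exact gradient. -/
noncomputable def stepError {n : ℕ} (xstar : EuclideanSpace ℝ (Fin n)) (α : ℝ)
    (z v θ : EuclideanSpace ℝ (Fin n)) : ℝ :=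
  α * inner ℝ θ (xstar - z) + α ^ 2 * ‖θ‖ ^ 2 + α ^ 2 * inner ℝ θ v

/-- One step of accelerated gradient descent with an inexact gradient `g`. -/
lemma potential_step {n : ℕ} {f : EuclideanSpace ℝ (Fin n) → ℝ} {L μ α A : ℝ}
    (hf : IsLSmooth f L) (hc : IsStronglyConvex f μ) (hμ : 0 ≤ μ) (hα : 0 < α) (hA : 0 ≤ A)
    (hαA : L * α ^ 2 ≤ A + α) {x y z g : EuclideanSpace ℝ (Fin n)}
    (xstar : EuclideanSpace ℝ (Fin n)) (hx : x = (A + α)⁻¹ • (A • y + α • z)) :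
    (A + α) * (f ((A + α)⁻¹ • (A • y + α • (z - α • g))) - f xstar)
      + ‖z - α • g - xstar‖ ^ 2 / 2 ≤
    A * (f y - f xstar) + ‖z - xstar‖ ^ 2 / 2
      + stepError xstar α z (gradient f x) (g - gradient f x) := by
  have hA' : 0 < A + α := by linarith
  set y' := (A + α)⁻¹ • (A • y + α • (z - α • g)) with hy'
  set v := gradient f x with hv
  have e1 : y' - x = -((A + α)⁻¹ * α ^ 2) • g := by
    rw [hy', hx]; module
  have e2 : (A + α) • x = A • y + α • z := by
    rw [hx, smul_smul, mul_inv_cancel₀ hA'.ne', one_smul]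
  have d1 := hf.descent x y'
  have d2 := hc.2 xstar x
  have d3 := hc.2 y x
  rw [← hv] at d1 d2 d3
  -- Within a run only convexity matters, so the quadratic terms are dropped. Strong convexity
  -- enters at the restarts, where it turns the gap into a distance.
  have p2 : 0 ≤ μ / 2 * ‖xstar - x‖ ^ 2 := by positivity
  have p3 : 0 ≤ μ / 2 * ‖y - x‖ ^ 2 := by positivity
  rw [e1, inner_smul_right, norm_smul, mul_pow, Real.norm_eq_abs, sq_abs] at d1
  have d1' : (A + α) * f y' ≤ (A + α) * f x - α ^ 2 * inner ℝ v g + α ^ 2 * ‖g‖ ^ 2 / 2 := by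
    have h1 := mul_le_mul_of_nonneg_left d1 hA'.le
    have h2 : (A + α) * (f x + -((A + α)⁻¹ * α ^ 2) * inner ℝ v g
        + L / 2 * ((-((A + α)⁻¹ * α ^ 2)) ^ 2 * ‖g‖ ^ 2))
        = (A + α) * f x - α ^ 2 * inner ℝ v g
          + (L * α ^ 2) * ((A + α)⁻¹ * (α ^ 2 * ‖g‖ ^ 2 / 2)) := by
      field_simp
      ring
    have h3 : (L * α ^ 2) * ((A + α)⁻¹ * (α ^ 2 * ‖g‖ ^ 2 / 2))
        ≤ (A + α) * ((A + α)⁻¹ * (α ^ 2 * ‖g‖ ^ 2 / 2)) := by gcongr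
    rw [mul_inv_cancel_left₀ hA'.ne'] at h3
    linarith
  -- The convexity inequalities towards `xstar` and `y` are weighted by `α` and `A`; the coupling
  -- `e2` then eliminates `x` and `y` from the linear terms.
  have d23 : (A + α) * f x - A * f y - α * f xstar ≤ α * inner ℝ v z - α * inner ℝ v xstar := by
    have h2 := mul_le_mul_of_nonneg_left (show f x + inner ℝ v (xstar - x) ≤ f xstar by linarith)
      hα.le
    have h3 := mul_le_mul_of_nonneg_left (show f x + inner ℝ v (y - x) ≤ f y by linarith) hA
    have h4 : (A + α) * inner ℝ v x = A * inner ℝ v y + α * inner ℝ v z := by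
      rw [← inner_smul_right, e2, inner_add_right, inner_smul_right, inner_smul_right]
    rw [inner_sub_right] at h2 h3
    linarith
  have e3 : ‖z - α • g - xstar‖ ^ 2
      = ‖z - xstar‖ ^ 2 - 2 * α * (inner ℝ g z - inner ℝ g xstar) + α ^ 2 * ‖g‖ ^ 2 := by
    rw [show z - α • g - xstar = (z - xstar) - α • g by abel, norm_sub_sq_real, inner_smul_right,
      norm_smul, mul_pow, Real.norm_eq_abs, sq_abs, inner_sub_left, real_inner_comm g z,
      real_inner_comm g xstar]
    ring
  -- With `θ = g - v`, the two halves of `α² ‖g‖²` and the term `-α² ⟨v, g⟩` combine to `α² ⟨θ, g⟩ =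
  -- α² (‖θ‖² + ⟨θ, v⟩)`.
  rw [e3, stepError, norm_sub_sq_real g, inner_sub_left, inner_sub_left, inner_sub_right,
    inner_sub_right, real_inner_self_eq_norm_sq, real_inner_comm v g]
  nlinarith

/-! ### Moments of a step -/

/-- The second moment of a sum of independent centred random vectors. -/
lemma integral_sq_norm_sum_le {n : ℕ} {Ω : Type*} [MeasurableSpace Ω] {P : Measure Ω}
    {U : ℕ → Ω → EuclideanSpace ℝ (Fin n)} {V : ℝ}
    (hindep : Pairwise fun i j => U i ⟂ᵢ[P] U j)
    (hint : ∀ i, Integrable (U i) P) (hzero : ∀ i, ∫ ω, U i ω ∂P = 0)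
    (hsq : ∀ i, Integrable (fun ω => ‖U i ω‖ ^ 2) P) (hV : ∀ i, ∫ ω, ‖U i ω‖ ^ 2 ∂P ≤ V) (m : ℕ) :
    Integrable (fun ω => ‖∑ i ∈ Finset.range m, U i ω‖ ^ 2) P ∧
      ∫ ω, ‖∑ i ∈ Finset.range m, U i ω‖ ^ 2 ∂P ≤ m * V := by
  have hii : ∀ i j, Integrable (fun ω => inner ℝ (U i ω) (U j ω)) P := by
    intro i j
    by_cases h : i = j
    · subst h; simpa using hsq i
    · exact (hindep h).integrable_bilin (hint i) (hint j) (innerSL ℝ)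
  have hne : ∀ i j, i ≠ j → ∫ ω, inner ℝ (U i ω) (U j ω) ∂P = 0 := by
    intro i j h
    exact ((hindep h).integral_bilin (hint i) (hint j) (innerSL ℝ)).trans (by simp [hzero])
  have hexp : ∀ ω, ‖∑ i ∈ Finset.range m, U i ω‖ ^ 2
      = ∑ i ∈ Finset.range m, ∑ j ∈ Finset.range m, inner ℝ (U i ω) (U j ω) := by
    intro ω
    rw [← real_inner_self_eq_norm_sq, sum_inner]
    exact Finset.sum_congr rfl fun i _ => inner_sum _ _ _
  simp_rw [hexp]
  refine ⟨integrable_finsetSum _ fun i _ => integrable_finsetSum _ fun j _ => hii i j, ?_⟩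
  rw [integral_finsetSum _ fun i _ => integrable_finsetSum _ fun j _ => hii i j]
  calc ∑ i ∈ Finset.range m, ∫ ω, ∑ j ∈ Finset.range m, inner ℝ (U i ω) (U j ω) ∂P
      ≤ ∑ i ∈ Finset.range m, V := by
        refine Finset.sum_le_sum fun i hi => ?_
        rw [integral_finsetSum _ fun j _ => hii i j, Finset.sum_eq_single_of_mem i hi
          fun j _ hj => hne i j hj.symm]
        simpa using hV i
    _ = m * V := by simp

/-- The mean and the variance of a mini-batched stochastic gradient. -/
lemma IsStochasticGradient.miniBatch_moments {n : ℕ} {S Ω : Type*} [MeasurableSpace S]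
    [MeasurableSpace Ω] {P : Measure Ω} [IsProbabilityMeasure P] {D : Measure S}
    {f : EuclideanSpace ℝ (Fin n) → ℝ}
    {G : EuclideanSpace ℝ (Fin n) → S → EuclideanSpace ℝ (Fin n)} {σ : ℝ}
    (hG : IsStochasticGradient f G D σ) {ξ : ℕ → Ω → S} (hξ : ∀ i, Measurable (ξ i))
    (hD : ∀ i, P.map (ξ i) = D) (hindep : iIndepFun ξ P) {m : ℕ} (hm : 0 < m)
    (x : EuclideanSpace ℝ (Fin n)) :
    Integrable (fun ω => miniBatch G m (fun i => ξ i ω) x - gradient f x) P ∧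
    ∫ ω, (miniBatch G m (fun i => ξ i ω) x - gradient f x) ∂P = 0 ∧
    Integrable (fun ω => ‖miniBatch G m (fun i => ξ i ω) x - gradient f x‖ ^ 2) P ∧
    ∫ ω, ‖miniBatch G m (fun i => ξ i ω) x - gradient f x‖ ^ 2 ∂P ≤ σ ^ 2 / m := by
  have hm' : (0 : ℝ) < m := by exact_mod_cast hm
  have hGx : Measurable (G x) := hG.measurable.comp measurable_prodMk_left
  have hDp : IsProbabilityMeasure D := by
    rw [← hD 0]; exact Measure.isProbabilityMeasure_map (hξ 0).aemeasurable
  set v := gradient f x with hv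
  set U : ℕ → Ω → EuclideanSpace ℝ (Fin n) := fun i ω => G x (ξ i ω) - v with hU
  have hmean : ∀ ω, miniBatch G m (fun i => ξ i ω) x - v
      = (m : ℝ)⁻¹ • ∑ i ∈ Finset.range m, U i ω := by
    intro ω
    simp only [hU, miniBatch, Finset.sum_sub_distrib, Finset.sum_const, Finset.card_range, smul_sub]
    rw [← Nat.cast_smul_eq_nsmul ℝ, smul_smul, inv_mul_cancel₀ hm'.ne', one_smul]
  have hi : ∀ i, Integrable (U i) P := fun i => by
    have h : Integrable (fun s => G x s - v) (P.map (ξ i)) := by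
      rw [hD i]; exact (hG.integrable x).sub (integrable_const v)
    exact h.comp_measurable (hξ i)
  have hz : ∀ i, ∫ ω, U i ω ∂P = 0 := fun i => by
    have h := integral_map (μ := P) (hξ i).aemeasurable (f := fun s => G x s - v)
      (hGx.sub_const v).aestronglyMeasurable
    rw [hD i, integral_sub (hG.integrable x) (integrable_const v), hG.unbiased x] at h
    simp only [hU, ← h]
    simp [hv]
  have hs : ∀ i, Integrable (fun ω => ‖U i ω‖ ^ 2) P := fun i => by
    have h : Integrable (fun s => ‖G x s - v‖ ^ 2) (P.map (ξ i)) := by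
      rw [hD i]; exact hG.integrable_sq x
    exact h.comp_measurable (hξ i)
  have hV : ∀ i, ∫ ω, ‖U i ω‖ ^ 2 ∂P ≤ σ ^ 2 := fun i => by
    have h := integral_map (μ := P) (hξ i).aemeasurable (f := fun s => ‖G x s - v‖ ^ 2)
      ((hGx.sub_const v).norm.pow_const 2).aestronglyMeasurable
    rw [hD i] at h
    rw [← h]
    exact hG.variance_le x
  have hp : Pairwise fun i j => U i ⟂ᵢ[P] U j := fun i j hij =>
    (hindep.indepFun hij).comp (hGx.sub_const v) (hGx.sub_const v)
  obtain ⟨h1, h2⟩ := integral_sq_norm_sum_le hp hi hz hs hV m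
  have hn : ∀ ω, ‖(m : ℝ)⁻¹ • ∑ i ∈ Finset.range m, U i ω‖ ^ 2
      = ((m : ℝ)⁻¹) ^ 2 * ‖∑ i ∈ Finset.range m, U i ω‖ ^ 2 := fun ω => by
    rw [norm_smul, mul_pow, Real.norm_eq_abs, sq_abs]
  simp_rw [hmean, hn]
  refine ⟨((integrable_finsetSum (Finset.range m) fun i _ => hi i).smul (m : ℝ)⁻¹ :), ?_, h1.const_mul _, ?_⟩
  · rw [integral_smul, integral_finsetSum _ fun i _ => hi i]
    simp [hz]
  · rw [integral_const_mul]
    calc ((m : ℝ)⁻¹) ^ 2 * ∫ ω, ‖∑ i ∈ Finset.range m, U i ω‖ ^ 2 ∂P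
        ≤ ((m : ℝ)⁻¹) ^ 2 * (m * σ ^ 2) := by gcongr
      _ = σ ^ 2 / m := by field_simp

/-- A pointwise bound for the exponential of the error of a clipped step. -/
lemma exp_stepError_le {n : ℕ} {xstar z v g : EuclideanSpace ℝ (Fin n)} {α ρ ℓ : ℝ} (hα : 0 < α)
    (hρ : 0 < ρ) (hℓ : 2 ≤ ℓ) (hz : ‖xstar - z‖ ≤ ρ) (hv : ‖v‖ ≤ ρ / (8 * ℓ) / α / 2) :
    Real.exp (4 * ℓ / ρ ^ 2 * stepError xstar α z v (clip g (ρ / (8 * ℓ) / α) - v)) ≤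
      1 + 4 * ℓ / ρ ^ 2 * inner ℝ (g - v) (α • (xstar - z) + α ^ 2 • v)
        + 41 * ℓ ^ 2 / ρ ^ 2 * (α ^ 2 * ‖g - v‖ ^ 2) := by
  have hℓ0 : 0 < ℓ := by linarith
  set B := ρ / (8 * ℓ) with hB
  have hB0 : 0 < B := by positivity
  have hBℓ : B * ℓ = ρ / 8 := by rw [hB]; field_simp
  have hBρ : B ≤ ρ / 16 := by nlinarith
  set l := B / α with hl
  have hl0 : 0 < l := by positivity
  have hlα : α * l = B := by rw [hl]; field_simp
  set θ := clip g l - v with hθ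
  set w := xstar - z with hw
  set N2 := ‖g - v‖ with hN2
  have hN0 : 0 ≤ N2 := norm_nonneg _
  have hθg : ‖θ‖ ≤ N2 := norm_clip_sub_le g hl0 hv
  have hθ0 : 0 ≤ ‖θ‖ := norm_nonneg _
  have hcg : ‖clip g l - g‖ ≤ N2 ^ 2 / (2 * l) := norm_sub_clip_le g hl0 hv
  have hθl : ‖θ‖ ≤ 3 / 2 * l := by
    calc ‖θ‖ ≤ ‖clip g l‖ + ‖v‖ := norm_sub_le _ _
      _ ≤ l + l / 2 := add_le_add (norm_clip_le g hl0.le) hv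
      _ = _ := by ring
  have hαθ : α * ‖θ‖ ≤ 3 / 2 * B := by
    calc α * ‖θ‖ ≤ α * (3 / 2 * l) := by gcongr
      _ = _ := by rw [← hlα]; ring
  have hαv : α * ‖v‖ ≤ B / 2 := by
    calc α * ‖v‖ ≤ α * (l / 2) := by gcongr
      _ = _ := by rw [← hlα]; ring
  set T := stepError xstar α z v θ with hT
  set s := 4 * ℓ / ρ ^ 2 with hs
  have hs0 : 0 < s := by positivity
  -- The factor `9 / 8` comes from `ρ + 3B/2 + B/2 = ρ + 2B` and `B ≤ ρ / 16`, where `ℓ ≥ 2` is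
  -- used.
  have hTabs : |T| ≤ α * ‖θ‖ * (9 / 8 * ρ) := by
    have h1 : |α * inner ℝ θ w| ≤ α * ‖θ‖ * ρ := by
      rw [abs_mul, abs_of_pos hα, mul_assoc]
      gcongr
      exact (abs_real_inner_le_norm θ w).trans (by gcongr)
    have h2 : |α ^ 2 * ‖θ‖ ^ 2| ≤ α * ‖θ‖ * (3 / 2 * B) := by
      rw [abs_of_nonneg (by positivity)]
      calc α ^ 2 * ‖θ‖ ^ 2 = α * ‖θ‖ * (α * ‖θ‖) := by ring
        _ ≤ _ := by gcongr
    have h3 : |α ^ 2 * inner ℝ θ v| ≤ α * ‖θ‖ * (B / 2) := by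
      rw [abs_mul, abs_of_pos (by positivity : 0 < α ^ 2)]
      calc α ^ 2 * |inner ℝ θ v| ≤ α ^ 2 * (‖θ‖ * ‖v‖) := by
            gcongr; exact abs_real_inner_le_norm θ v
        _ = α * ‖θ‖ * (α * ‖v‖) := by ring
        _ ≤ _ := by gcongr
    calc |T| ≤ |α * inner ℝ θ w| + |α ^ 2 * ‖θ‖ ^ 2| + |α ^ 2 * inner ℝ θ v| := abs_add_three _ _ _
      _ ≤ α * ‖θ‖ * ρ + α * ‖θ‖ * (3 / 2 * B) + α * ‖θ‖ * (B / 2) := by gcongr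
      _ = α * ‖θ‖ * (ρ + 2 * B) := by ring
      _ ≤ _ := by gcongr; linarith
  have hsT : |s * T| ≤ 1 := by
    rw [abs_mul, abs_of_pos hs0]
    calc s * |T| ≤ s * (3 / 2 * B * (9 / 8 * ρ)) := by
          gcongr
          exact hTabs.trans (by gcongr)
      _ = 27 / 4 * (B * ℓ) / ρ := by rw [hs]; field_simp; ring
      _ = 27 / 32 := by rw [hBℓ]; field_simp; norm_num
      _ ≤ 1 := by norm_num
  have hexp : Real.exp (s * T) ≤ 1 + s * T + (s * T) ^ 2 := by
    have := (abs_le.1 (Real.abs_exp_sub_one_sub_id_le hsT)).2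
    linarith
  have hsq : (s * T) ^ 2 ≤ 81 / 4 * ℓ ^ 2 / ρ ^ 2 * (α ^ 2 * N2 ^ 2) := by
    calc (s * T) ^ 2 = s ^ 2 * |T| ^ 2 := by rw [mul_pow, sq_abs]
      _ ≤ s ^ 2 * (α * N2 * (9 / 8 * ρ)) ^ 2 := by
          gcongr
          exact hTabs.trans (by gcongr)
      _ = _ := by rw [hs]; field_simp; ring
  -- Splitting `θ = (g - v) + (clip g l - g)` isolates a part linear in the unclipped noise, which
  -- will integrate to zero. Paired with a vector of size about `αρ`, the bias costs `4ℓ + 1/4`;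
  -- together with `‖θ‖²` this is at most `5ℓ`.
  have hlin : T ≤ inner ℝ (g - v) (α • w + α ^ 2 • v) + 5 * ℓ * (α ^ 2 * N2 ^ 2) := by
    have e : T = inner ℝ (g - v) (α • w + α ^ 2 • v)
        + inner ℝ (clip g l - g) (α • w + α ^ 2 • v) + α ^ 2 * ‖θ‖ ^ 2 := by
      have h1 : θ = (g - v) + (clip g l - g) := by rw [hθ]; abel
      rw [← inner_add_left, ← h1, inner_add_right, inner_smul_right, inner_smul_right, hT,
        stepError]
      ring
    have h1 : inner ℝ (clip g l - g) (α • w + α ^ 2 • v)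
        ≤ N2 ^ 2 / (2 * l) * (α * ρ + α * (B / 2)) := by
      refine (real_inner_le_norm _ _).trans ?_
      gcongr
      calc ‖α • w + α ^ 2 • v‖ ≤ α * ‖w‖ + α * (α * ‖v‖) := by
            refine (norm_add_le _ _).trans (le_of_eq ?_)
            rw [norm_smul, norm_smul, Real.norm_of_nonneg hα.le, Real.norm_of_nonneg (sq_nonneg α)]
            ring
        _ ≤ _ := by gcongr
    have h2 : N2 ^ 2 / (2 * l) * (α * ρ + α * (B / 2)) = (4 * ℓ + 1 / 4) * (α ^ 2 * N2 ^ 2) := by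
      rw [hl, hB]; field_simp; ring
    have h3 : α ^ 2 * ‖θ‖ ^ 2 ≤ α ^ 2 * N2 ^ 2 := by gcongr
    have h4 : 0 ≤ α ^ 2 * N2 ^ 2 := by positivity
    rw [e]
    nlinarith
  calc Real.exp (s * T) ≤ 1 + s * T + (s * T) ^ 2 := hexp
    _ ≤ 1 + s * (inner ℝ (g - v) (α • w + α ^ 2 • v) + 5 * ℓ * (α ^ 2 * N2 ^ 2))
        + 81 / 4 * ℓ ^ 2 / ρ ^ 2 * (α ^ 2 * N2 ^ 2) := by gcongr
    _ = 1 + s * inner ℝ (g - v) (α • w + α ^ 2 • v)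
        + (161 / 4) * ℓ ^ 2 / ρ ^ 2 * (α ^ 2 * N2 ^ 2) := by rw [hs]; field_simp; ring
    _ ≤ _ := by gcongr; norm_num

/-- The exponential moment of the error of a clipped step. -/
lemma lintegral_exp_stepError_le {n : ℕ} {Ω : Type*} [MeasurableSpace Ω] {P : Measure Ω}
    [IsProbabilityMeasure P] {g : Ω → EuclideanSpace ℝ (Fin n)} {xstar z v : EuclideanSpace ℝ (Fin n)}
    {α ρ ℓ V : ℝ} (hα : 0 < α) (hρ : 0 < ρ) (hℓ : 2 ≤ ℓ) (hz : ‖xstar - z‖ ≤ ρ)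
    (hv : ‖v‖ ≤ ρ / (8 * ℓ) / α / 2) (hint : Integrable (fun ω => g ω - v) P)
    (hzero : ∫ ω, (g ω - v) ∂P = 0) (hsq : Integrable (fun ω => ‖g ω - v‖ ^ 2) P)
    (hV : ∫ ω, ‖g ω - v‖ ^ 2 ∂P ≤ V) :
    ∫⁻ ω, ENNReal.ofReal (Real.exp (4 * ℓ / ρ ^ 2 *
        stepError xstar α z v (clip (g ω) (ρ / (8 * ℓ) / α) - v))) ∂P ≤
      ENNReal.ofReal (Real.exp (41 * ℓ ^ 2 / ρ ^ 2 * (α ^ 2 * V))) := by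
  have hb := fun ω => exp_stepError_le (g := g ω) hα hρ hℓ hz hv
  set w := α • (xstar - z) + α ^ 2 • v with hw
  have hin : Integrable (fun ω => inner ℝ (g ω - v) w) P := hint.inner_const w
  have hI : Integrable (fun ω => 1 + 4 * ℓ / ρ ^ 2 * inner ℝ (g ω - v) w
        + 41 * ℓ ^ 2 / ρ ^ 2 * (α ^ 2 * ‖g ω - v‖ ^ 2)) P :=
    ((integrable_const 1).add (hin.const_mul _)).add ((hsq.const_mul _).const_mul _)
  have hzero' : ∫ ω, inner ℝ (g ω - v) w ∂P = 0 := by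
    simp_rw [real_inner_comm w]
    rw [integral_inner hint, hzero, inner_zero_right]
  refine (lintegral_mono fun ω => ENNReal.ofReal_le_ofReal (hb ω)).trans ?_
  rw [← ofReal_integral_eq_lintegral_ofReal hI
    (.of_forall fun ω => (Real.exp_nonneg _).trans (hb ω))]
  refine ENNReal.ofReal_le_ofReal ?_
  have hc : Integrable (fun _ : Ω => (1 : ℝ)) P := integrable_const 1
  have hc1 : Integrable (fun ω => 1 + 4 * ℓ / ρ ^ 2 * inner ℝ (g ω - v) w) P :=
    hc.add (hin.const_mul _)
  rw [integral_add hc1 ((hsq.const_mul _).const_mul _), integral_add hc (hin.const_mul _),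
    integral_const_mul, integral_const_mul,
    integral_const_mul, hzero', integral_const, probReal_univ, one_smul, mul_zero, add_zero]
  calc 1 + 41 * ℓ ^ 2 / ρ ^ 2 * (α ^ 2 * ∫ ω, ‖g ω - v‖ ^ 2 ∂P)
      ≤ 41 * ℓ ^ 2 / ρ ^ 2 * (α ^ 2 * V) + 1 := by rw [add_comm]; gcongr
    _ ≤ _ := Real.add_one_le_exp _

/-- Under independence the joint law is a product, so Tonelli's theorem lets the past `X` be frozen
and the bound for each fixed value be integrated. This plays the role of conditioning on the past.
-/
lemma lintegral_le_mul_of_indepFun {Ω 𝓧 𝓨 : Type*} [MeasurableSpace Ω] [MeasurableSpace 𝓧]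
    [MeasurableSpace 𝓨] {P : Measure Ω} [IsProbabilityMeasure P] {X : Ω → 𝓧} {Y : Ω → 𝓨}
    (hX : Measurable X) (hY : Measurable Y) (hXY : X ⟂ᵢ[P] Y) {h : 𝓧 × 𝓨 → ENNReal}
    (hh : Measurable h) {u : 𝓧 → ENNReal} (hu : Measurable u) {c : ENNReal}
    (hle : ∀ x, ∫⁻ ω, h (x, Y ω) ∂P ≤ u x * c) :
    ∫⁻ ω, h (X ω, Y ω) ∂P ≤ (∫⁻ ω, u (X ω) ∂P) * c := by
  have : IsProbabilityMeasure (P.map Y) := Measure.isProbabilityMeasure_map hY.aemeasurable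
  rw [← lintegral_map hh (hX.prodMk hY),
    hXY.map_prod_eq_prod_map_map hX.aemeasurable hY.aemeasurable,
    lintegral_prod _ hh.aemeasurable, ← lintegral_map hu hX, ← lintegral_mul_const _ hu]
  refine lintegral_mono fun x => ?_
  rw [lintegral_map (f := fun y => h (x, y)) (hh.comp measurable_prodMk_left) hY]
  exact hle x

/-! ### A run on the event that the errors stay small -/

open Classical in
/-- The error of iteration `k` from the state `p = (y, z)` with samples `u`, set to zero unless `z`
is within `ρ` of `xstar` and the gradient is at most half the clipping level. -/
noncomputable def truncError {n : ℕ} {S : Type*} (f : EuclideanSpace ℝ (Fin n) → ℝ)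
    (G : EuclideanSpace ℝ (Fin n) → S → EuclideanSpace ℝ (Fin n))
    (xstar : EuclideanSpace ℝ (Fin n)) (L a ρ ℓ : ℝ) (m : ℕ → ℕ) (k : ℕ)
    (p : EuclideanSpace ℝ (Fin n) × EuclideanSpace ℝ (Fin n)) (u : ℕ → S) : ℝ :=
  if ‖xstar - p.2‖ ≤ ρ ∧
      ‖gradient f (xPoint a L k p.1 p.2)‖ ≤ ρ / (8 * ℓ) / alpha a L (k + 1) / 2 then
    stepError xstar (alpha a L (k + 1)) p.2 (gradient f (xPoint a L k p.1 p.2))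
      (clip (miniBatch G (m k) u (xPoint a L k p.1 p.2)) (ρ / (8 * ℓ) / alpha a L (k + 1))
        - gradient f (xPoint a L k p.1 p.2))
  else 0

/-- The sum of the truncated errors of the first `k` iterations. -/
noncomputable def errorSum {n : ℕ} {S : Type*} (f : EuclideanSpace ℝ (Fin n) → ℝ)
    (G : EuclideanSpace ℝ (Fin n) → S → EuclideanSpace ℝ (Fin n))
    (xstar : EuclideanSpace ℝ (Fin n)) (L a ρ ℓ : ℝ) (m : ℕ → ℕ) (s : ℕ → ℕ → S)
    (x0 : EuclideanSpace ℝ (Fin n)) (k : ℕ) : ℝ :=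
  ∑ i ∈ Finset.range k,
    truncError f G xstar L a ρ ℓ m i (iter G L a (ρ / (8 * ℓ)) m s x0 i) (s i)

/-- The first iteration is separate because `A_0 = 0` carries no information on `f y`. Here the
query point is `z` itself, and smoothness gives `Lρ` against the half-level `ρ a L / (16ℓ)`. -/
lemma gradient_xPoint_zero_le {n : ℕ} {f : EuclideanSpace ℝ (Fin n) → ℝ} {L a ρ ℓ : ℝ}
    (hf : IsLSmooth f L) (hL : 0 < L) {xstar y z : EuclideanSpace ℝ (Fin n)}
    (hmin : ∀ x, f xstar ≤ f x) (hρ : 0 < ρ) (hℓ : 2 ≤ ℓ) (ha : 16 * ℓ ≤ a)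
    (hz : ‖z - xstar‖ ≤ ρ) :
    ‖gradient f (xPoint a L 0 y z)‖ ≤ ρ / (8 * ℓ) / alpha a L (0 + 1) / 2 := by
  have ha0 : 0 < a := by linarith
  have hx : xPoint a L 0 y z = z := by
    have h := (alpha_succ_pos ha0 hL 0).ne'
    simp only [xPoint, bigA, zero_smul, zero_add, smul_smul] at h ⊢
    rw [inv_mul_cancel₀ h, one_smul]
  have h := hf.2 z xstar
  rw [gradient_eq_zero_of_forall_le hmin, sub_zero] at h
  rw [hx, alpha_succ]
  calc ‖gradient f z‖ ≤ L * ρ := h.trans (by gcongr)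
    _ = L * ρ * (16 * ℓ) / (16 * ℓ) := by field_simp
    _ ≤ L * ρ * a / (16 * ℓ) := by gcongr
    _ = _ := by norm_num; field_simp; norm_num

/-- The gradient at the extrapolated point is at most half the clipping level. -/
lemma gradient_xPoint_le {n : ℕ} {f : EuclideanSpace ℝ (Fin n) → ℝ} {L a ρ ℓ : ℝ}
    (hf : IsLSmooth f L) (hL : 0 < L) {xstar y z : EuclideanSpace ℝ (Fin n)}
    (hmin : ∀ x, f xstar ≤ f x) (hρ : 0 < ρ) (hℓ : 2 ≤ ℓ)
    (ha : 36 * (2 * ℓ + √(4 * ℓ ^ 2 + 2 * ℓ)) ^ 2 ≤ a) (k : ℕ)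
    (hz : ‖z - xstar‖ ≤ ρ) (hy : ‖y - xstar‖ ≤ ρ)
    (hfy : bigA a L k * (f y - f xstar) ≤ ρ ^ 2 / 2) :
    ‖gradient f (xPoint a L k y z)‖ ≤ ρ / (8 * ℓ) / alpha a L (k + 1) / 2 := by
  set r := √(4 * ℓ ^ 2 + 2 * ℓ) with hr
  have hr0 : 0 ≤ r := Real.sqrt_nonneg _
  have hr2 : r ^ 2 = 4 * ℓ ^ 2 + 2 * ℓ := Real.sq_sqrt (by positivity)
  have ha0 : 0 < a := lt_of_lt_of_le (by positivity) ha
  set q := √a with hq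
  have hq0 : 0 ≤ q := Real.sqrt_nonneg _
  have hq2 : q ^ 2 = a := Real.sq_sqrt ha0.le
  have hqr : 6 * (2 * ℓ + r) ≤ q := by
    refine Real.le_sqrt_of_sq_le ?_
    linarith [mul_pow (6 : ℝ) (2 * ℓ + r) 2]
  rcases Nat.eq_zero_or_pos k with rfl | hk
  · exact gradient_xPoint_zero_le hf hL hmin hρ hℓ (by nlinarith) hz
  have hk1 : (1 : ℝ) ≤ k := by exact_mod_cast hk
  have hα := alpha_succ_pos ha0 hL k
  have hA' := bigA_succ_pos ha0 hL k
  set x := xPoint a L k y z with hx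
  have hxy : x - y = (alpha a L (k + 1) / bigA a L (k + 1)) • (z - y) := by
    have h : bigA a L k = bigA a L (k + 1) - alpha a L (k + 1) := by rw [bigA]; ring
    have h' : (bigA a L (k + 1) - alpha a L (k + 1)) • y + alpha a L (k + 1) • z
        = bigA a L (k + 1) • y + alpha a L (k + 1) • (z - y) := by module
    rw [hx, xPoint, h, h', div_eq_inv_mul, mul_smul, smul_add, inv_smul_smul₀ hA'.ne',
      add_sub_cancel_left]
  have hzy : ‖z - y‖ ≤ 2 * ρ := by
    calc ‖z - y‖ = ‖(z - xstar) - (y - xstar)‖ := by congr 1; abel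
      _ ≤ _ := (norm_sub_le _ _).trans (by linarith)
  have hαA : ((k : ℝ) + 2) * (alpha a L (k + 1) / bigA a L (k + 1)) ≤ 2 := by
    rw [bigA_eq ha0 hL, alpha_succ]
    have : ((k : ℝ) + 2) * ((k + 2) / (2 * a * L) / (((k + 1 : ℕ) : ℝ) * (((k + 1 : ℕ) : ℝ) + 3)
        / (4 * a * L))) = 2 * (k + 2) ^ 2 / ((k + 1) * (k + 4)) := by
      push_cast
      field_simp
      ring
    rw [this, div_le_iff₀ (by positivity)]
    nlinarith
  have h1 : ((k : ℝ) + 2) * ‖gradient f x - gradient f y‖ ≤ 4 * ρ * L := by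
    calc ((k : ℝ) + 2) * ‖gradient f x - gradient f y‖
        ≤ (k + 2) * (L * ‖x - y‖) := by gcongr; exact hf.2 x y
      _ = (k + 2) * (alpha a L (k + 1) / bigA a L (k + 1)) * (L * ‖z - y‖) := by
          rw [hxy, norm_smul, Real.norm_of_nonneg (by positivity)]; ring
      _ ≤ 2 * (L * (2 * ρ)) := by gcongr
      _ = _ := by ring
  -- The gap at `y` controls its gradient, and `A_k` controls the gap. The constant `9 / 4` is sharp
  -- at `k = 1`.
  have h2 : ((k : ℝ) + 2) * ‖gradient f y‖ ≤ 3 * q * L * ρ := by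
    refine abs_le_of_sq_le_sq' ?_ (by positivity) |>.2
    have hg := hf.sq_norm_gradient_le hL hmin y
    rw [bigA_eq ha0 hL, div_mul_eq_mul_div, div_le_iff₀ (by positivity)] at hfy
    have hkk : ((k : ℝ) + 2) ^ 2 ≤ 9 / 4 * (k * (k + 3)) := by nlinarith
    have hf0 : 0 ≤ f y - f xstar := by linarith [hmin y]
    calc (((k : ℝ) + 2) * ‖gradient f y‖) ^ 2 = (k + 2) ^ 2 * ‖gradient f y‖ ^ 2 := by ring
      _ ≤ 9 / 4 * (k * (k + 3)) * (2 * L * (f y - f xstar)) := by gcongr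
      _ = 9 / 2 * L * (k * (k + 3) * (f y - f xstar)) := by ring
      _ ≤ 9 / 2 * L * (ρ ^ 2 / 2 * (4 * a * L)) := by gcongr
      _ = _ := by rw [← hq2]; ring
  -- This is the quadratic inequality `q² - 24ℓq - 32ℓ ≥ 0` in `q = √a`. After completing the square
  -- it follows from `q ≥ 12ℓ + 6r`, which is where the lower bound on `a` is used.
  have h3 : 4 + 3 * q ≤ a / (8 * ℓ) := by
    rw [le_div_iff₀ (by positivity), ← hq2]
    have : (6 * r) ^ 2 ≤ (q - 12 * ℓ) ^ 2 := by gcongr; linarith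
    nlinarith
  have h4 : ((k : ℝ) + 2) * ‖gradient f x‖ ≤ ρ * L * (a / (8 * ℓ)) := by
    have ht : ‖gradient f x‖ ≤ ‖gradient f x - gradient f y‖ + ‖gradient f y‖ := by
      simpa using norm_add_le (gradient f x - gradient f y) (gradient f y)
    calc ((k : ℝ) + 2) * ‖gradient f x‖
        ≤ (k + 2) * (‖gradient f x - gradient f y‖ + ‖gradient f y‖) := by gcongr
      _ ≤ ρ * L * (4 + 3 * q) := by linarith
      _ ≤ _ := by gcongr
  have h5 : ρ / (8 * ℓ) / alpha a L (k + 1) / 2 = ρ * L * (a / (8 * ℓ)) / (k + 2) := by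
    rw [alpha_succ]; field_simp
  rw [h5, le_div_iff₀ (by positivity)]
  linarith

/-- As long as the accumulated errors stay small, the potential stays bounded. -/
lemma potential_le_of_errorSum_le {n : ℕ} {S : Type*} {f : EuclideanSpace ℝ (Fin n) → ℝ}
    {G : EuclideanSpace ℝ (Fin n) → S → EuclideanSpace ℝ (Fin n)} {L μ a ρ ℓ : ℝ}
    (hf : IsLSmooth f L) (hc : IsStronglyConvex f μ) (hL : 0 < L) (hμ : 0 ≤ μ)
    {x0 xstar : EuclideanSpace ℝ (Fin n)} (hmin : ∀ x, f xstar ≤ f x) (hρ : 0 < ρ) (hℓ : 2 ≤ ℓ)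
    (ha1 : 1 ≤ a) (ha : 36 * (2 * ℓ + √(4 * ℓ ^ 2 + 2 * ℓ)) ^ 2 ≤ a)
    {m : ℕ → ℕ} {s : ℕ → ℕ → S} (hx0 : ‖x0 - xstar‖ ^ 2 ≤ ρ ^ 2 / 5) {N : ℕ}
    (hsum : ∀ k ≤ N, errorSum f G xstar L a ρ ℓ m s x0 k ≤ 2 / 5 * ρ ^ 2) (k : ℕ) (hk : k ≤ N) :
    bigA a L k * (f (iter G L a (ρ / (8 * ℓ)) m s x0 k).1 - f xstar)
        + ‖(iter G L a (ρ / (8 * ℓ)) m s x0 k).2 - xstar‖ ^ 2 / 2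
      ≤ ρ ^ 2 / 10 + errorSum f G xstar L a ρ ℓ m s x0 k ∧
    ‖(iter G L a (ρ / (8 * ℓ)) m s x0 k).1 - xstar‖ ≤ ρ := by
  have ha0 : 0 < a := by linarith
  induction k with
  | zero =>
    simp only [iter, bigA, errorSum, Finset.range_zero, Finset.sum_empty]
    exact ⟨by linarith, abs_le_of_sq_le_sq' (by nlinarith) hρ.le |>.2⟩
  | succ k ih =>
    obtain ⟨ih1, ih2⟩ := ih (by omega)
    have hs := hsum k (by omega)
    have hs' := hsum (k + 1) hk
    have hA := bigA_nonneg ha0 hL k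
    have hα := alpha_succ_pos ha0 hL k
    have hA' := bigA_succ_pos ha0 hL k
    set p := iter G L a (ρ / (8 * ℓ)) m s x0 k with hp
    have hfy : 0 ≤ bigA a L k * (f p.1 - f xstar) := mul_nonneg hA (by linarith [hmin p.1])
    -- The potential is at most `ρ² / 10 + 2ρ² / 5 = ρ² / 2`.
    have hz : ‖p.2 - xstar‖ ≤ ρ := abs_le_of_sq_le_sq' (by linarith) hρ.le |>.2
    have hgrad := gradient_xPoint_le hf hL hmin hρ hℓ ha k hz ih2
      (by linarith [sq_nonneg ‖p.2 - xstar‖])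
    have hstep := potential_step (x := xPoint a L k p.1 p.2) (y := p.1) (z := p.2)
      (g := clip (miniBatch G (m k) (s k) (xPoint a L k p.1 p.2))
        (ρ / (8 * ℓ) / alpha a L (k + 1))) hf hc hμ hα hA (sq_alpha_mul_le ha1 hL k) xstar rfl
    -- Both guards of `truncError` hold here, so the truncated error is the true one.
    have herr : errorSum f G xstar L a ρ ℓ m s x0 (k + 1) = errorSum f G xstar L a ρ ℓ m s x0 k
        + stepError xstar (alpha a L (k + 1)) p.2 (gradient f (xPoint a L k p.1 p.2))
          (clip (miniBatch G (m k) (s k) (xPoint a L k p.1 p.2)) (ρ / (8 * ℓ) / alpha a L (k + 1))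
            - gradient f (xPoint a L k p.1 p.2)) := by
      rw [errorSum, Finset.sum_range_succ, ← errorSum, truncError, ← hp,
        if_pos ⟨by rwa [norm_sub_rev], hgrad⟩]
    set p' := iter G L a (ρ / (8 * ℓ)) m s x0 (k + 1) with hp'
    have hpot : bigA a L (k + 1) * (f p'.1 - f xstar) + ‖p'.2 - xstar‖ ^ 2 / 2
        ≤ ρ ^ 2 / 10 + errorSum f G xstar L a ρ ℓ m s x0 (k + 1) := by
      have : bigA a L (k + 1) * (f p'.1 - f xstar) + ‖p'.2 - xstar‖ ^ 2 / 2 ≤ _ := hstep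
      linarith
    refine ⟨hpot, ?_⟩
    have hfy' : 0 ≤ bigA a L (k + 1) * (f p'.1 - f xstar) :=
      mul_nonneg hA'.le (by linarith [hmin p'.1])
    have hz' : ‖p'.2 - xstar‖ ≤ ρ := abs_le_of_sq_le_sq' (by linarith) hρ.le |>.2
    -- The potential bounds only `z` in norm; the new `y` stays in the ball as a convex combination
    -- of the old `y` and the new `z`.
    have e : p'.1 - xstar = (bigA a L (k + 1))⁻¹ •
        (bigA a L k • (p.1 - xstar) + alpha a L (k + 1) • (p'.2 - xstar)) := by
      have e1 : p'.1 = (bigA a L (k + 1))⁻¹ • (bigA a L k • p.1 + alpha a L (k + 1) • p'.2) := rfl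
      have e2 : xstar = (bigA a L (k + 1))⁻¹ •
          (bigA a L k • xstar + alpha a L (k + 1) • xstar) := by
        rw [← add_smul, smul_smul]
        exact (by rw [← bigA, inv_mul_cancel₀ hA'.ne', one_smul])
      rw [e1]
      nth_rewrite 1 [e2]
      module
    rw [e, norm_smul, Real.norm_of_nonneg (inv_nonneg.2 hA'.le), inv_mul_le_iff₀ hA']
    calc ‖bigA a L k • (p.1 - xstar) + alpha a L (k + 1) • (p'.2 - xstar)‖
        ≤ bigA a L k * ‖p.1 - xstar‖ + alpha a L (k + 1) * ‖p'.2 - xstar‖ := by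
          refine (norm_add_le _ _).trans (le_of_eq ?_)
          rw [norm_smul, norm_smul, Real.norm_of_nonneg hA, Real.norm_of_nonneg hα.le]
      _ ≤ bigA a L k * ρ + alpha a L (k + 1) * ρ := by gcongr
      _ = _ := by rw [bigA]; ring

/-- One run halves the initial gap when the accumulated errors stay small. -/
lemma gap_le_of_errorSum_le {n : ℕ} {S : Type*} {f : EuclideanSpace ℝ (Fin n) → ℝ}
    {G : EuclideanSpace ℝ (Fin n) → S → EuclideanSpace ℝ (Fin n)} {L μ a ρ ℓ : ℝ}
    (hf : IsLSmooth f L) (hc : IsStronglyConvex f μ) (hL : 0 < L) (hμ : 0 < μ)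
    {x0 xstar : EuclideanSpace ℝ (Fin n)} (hmin : ∀ x, f xstar ≤ f x) (hρ : 0 < ρ) (hℓ : 2 ≤ ℓ)
    (ha1 : 1 ≤ a) (ha : 36 * (2 * ℓ + √(4 * ℓ ^ 2 + 2 * ℓ)) ^ 2 ≤ a)
    {m : ℕ → ℕ} {s : ℕ → ℕ → S} (hx0 : f x0 - f xstar ≤ μ * ρ ^ 2 / 10) {N : ℕ} (hN1 : 1 ≤ N)
    (hN : 40 * a * L / μ ≤ (N : ℝ) ^ 2)
    (hsum : ∀ k ≤ N, errorSum f G xstar L a ρ ℓ m s x0 k ≤ 2 / 5 * ρ ^ 2) :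
    f (iter G L a (ρ / (8 * ℓ)) m s x0 N).1 - f xstar ≤ μ * ρ ^ 2 / 20 := by
  have ha0 : 0 < a := by linarith
  have hd := hc.sq_norm_sub_le hmin x0
  have hd' : ‖x0 - xstar‖ ^ 2 ≤ ρ ^ 2 / 5 := by
    have : μ * ‖x0 - xstar‖ ^ 2 ≤ μ * (ρ ^ 2 / 5) := by linarith
    exact le_of_mul_le_mul_left this hμ
  obtain ⟨h, -⟩ := potential_le_of_errorSum_le hf hc hL hμ.le hmin hρ hℓ ha1 ha hd' hsum N le_rfl
  set y := (iter G L a (ρ / (8 * ℓ)) m s x0 N).1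
  have hy := hmin y
  have h1 : bigA a L N * (f y - f xstar) ≤ ρ ^ 2 / 2 := by
    have := hsum N le_rfl
    have := sq_nonneg ‖(iter G L a (ρ / (8 * ℓ)) m s x0 N).2 - xstar‖
    linarith
  rw [bigA_eq ha0 hL, div_mul_eq_mul_div, div_le_iff₀ (by positivity)] at h1
  rw [div_le_iff₀ hμ] at hN
  have hN0 : (1 : ℝ) ≤ N := by exact_mod_cast hN1
  have h2 : (N : ℝ) ^ 2 * (f y - f xstar) ≤ N * (N + 3) * (f y - f xstar) := by
    refine mul_le_mul_of_nonneg_right ?_ (by linarith)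
    nlinarith
  -- The potential bound reads `N(N + 3) · gap ≤ 2aLρ²`, while `40aL ≤ N²μ`.
  have h3 : (N : ℝ) ^ 2 * (f y - f xstar) ≤ N ^ 2 * (μ * ρ ^ 2 / 20) := by
    have : ρ ^ 2 * (40 * a * L) ≤ ρ ^ 2 * ((N : ℝ) ^ 2 * μ) := by gcongr
    linarith
  exact le_of_mul_le_mul_left h3 (by positivity)

/-! ### Measurability -/

lemma measurable_clip {n : ℕ} {Ω : Type*} [MeasurableSpace Ω]
    {g : Ω → EuclideanSpace ℝ (Fin n)} (hg : Measurable g) (l : ℝ) :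
    Measurable fun ω => clip (g ω) l :=
  (measurable_const.min (measurable_const.div hg.norm)).smul hg

lemma measurable_miniBatch {n : ℕ} {S Ω : Type*} [MeasurableSpace S] [MeasurableSpace Ω]
    {G : EuclideanSpace ℝ (Fin n) → S → EuclideanSpace ℝ (Fin n)}
    (hG : Measurable (Function.uncurry G)) (m : ℕ) {u : Ω → ℕ → S} (hu : Measurable u)
    {x : Ω → EuclideanSpace ℝ (Fin n)} (hx : Measurable x) :
    Measurable fun ω => miniBatch G m (u ω) (x ω) := by
  have h : Measurable fun ω => ∑ i ∈ Finset.range m, G (x ω) (u ω i) :=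
    Finset.measurable_sum _ fun i _ => hG.comp (hx.prodMk ((measurable_pi_apply i).comp hu))
  exact h.const_smul (m : ℝ)⁻¹

lemma measurable_xPoint {n : ℕ} {Ω : Type*} [MeasurableSpace Ω] (a L : ℝ) (k : ℕ)
    {y z : Ω → EuclideanSpace ℝ (Fin n)} (hy : Measurable y) (hz : Measurable z) :
    Measurable fun ω => xPoint a L k (y ω) (z ω) :=
  ((hy.const_smul (bigA a L k)).add (hz.const_smul (alpha a L (k + 1)))).const_smul
    (bigA a L (k + 1))⁻¹

/-- Only row `k` of the samples is assumed measurable, since the lemma is applied with `past ξ t (k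
+ 1)` as σ-algebra, which does not include the later rows. -/
lemma measurable_iter_succ {n : ℕ} {S Ω : Type*} [MeasurableSpace S] [MeasurableSpace Ω]
    {G : EuclideanSpace ℝ (Fin n) → S → EuclideanSpace ℝ (Fin n)}
    (hG : Measurable (Function.uncurry G)) (L a B : ℝ) (m : ℕ → ℕ) (k : ℕ)
    {s : Ω → ℕ → ℕ → S} {x0 : Ω → EuclideanSpace ℝ (Fin n)} (hs : Measurable fun ω => s ω k)
    (hp : Measurable fun ω => iter G L a B m (s ω) (x0 ω) k) :
    Measurable fun ω => iter G L a B m (s ω) (x0 ω) (k + 1) := by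
  have hz := hp.snd.sub ((measurable_clip (measurable_miniBatch hG (m k) hs
    (measurable_xPoint a L k hp.fst hp.snd)) (B / alpha a L (k + 1))).const_smul
      (alpha a L (k + 1)))
  exact (((hp.fst.const_smul (bigA a L k)).add (hz.const_smul (alpha a L (k + 1)))).const_smul
    (bigA a L (k + 1))⁻¹).prodMk hz

lemma measurable_truncError {n : ℕ} {S Ω : Type*} [MeasurableSpace S] [MeasurableSpace Ω]
    {f : EuclideanSpace ℝ (Fin n) → ℝ} (hf : Measurable (gradient f))
    {G : EuclideanSpace ℝ (Fin n) → S → EuclideanSpace ℝ (Fin n)}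
    (hG : Measurable (Function.uncurry G)) (xstar : EuclideanSpace ℝ (Fin n)) (L a ρ ℓ : ℝ)
    (m : ℕ → ℕ) (k : ℕ) {p : Ω → EuclideanSpace ℝ (Fin n) × EuclideanSpace ℝ (Fin n)}
    (hp : Measurable p) {u : Ω → ℕ → S} (hu : Measurable u) :
    Measurable fun ω => truncError f G xstar L a ρ ℓ m k (p ω) (u ω) := by
  have hx := measurable_xPoint a L k hp.fst hp.snd
  have hv := hf.comp hx
  have hθ := (measurable_clip (measurable_miniBatch hG (m k) hu hx)
    (ρ / (8 * ℓ) / alpha a L (k + 1))).sub hv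
  have hw := hp.snd.const_sub xstar
  refine Measurable.ite ?_ ?_ measurable_const
  · exact (measurableSet_le hw.norm measurable_const).inter
      (measurableSet_le hv.norm measurable_const)
  · exact (((hθ.inner hw).const_mul _).add ((hθ.norm.pow_const 2).const_mul _)).add
      ((hθ.inner hv).const_mul _)

/-! ### The filtration of past samples and independence of fresh ones -/

/-- The `σ`-algebra generated by the samples used before iteration `k` of run `t`. -/
@[reducible] def past {S Ω : Type*} [mS : MeasurableSpace S] (ξ : ℕ → ℕ → ℕ → Ω → S) (t k : ℕ) :
    MeasurableSpace Ω :=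
  ⨆ j ∈ {j : ℕ × ℕ × ℕ | j.1 < t ∨ j.1 = t ∧ j.2.1 < k}, mS.comap (ξ j.1 j.2.1 j.2.2)

lemma past_mono {S Ω : Type*} [MeasurableSpace S] (ξ : ℕ → ℕ → ℕ → Ω → S) {t t' k k' : ℕ}
    (h : t < t' ∨ t = t' ∧ k ≤ k') : past ξ t k ≤ past ξ t' k' :=
  biSup_mono fun j (hj : _ ∨ _) => show _ ∨ _ by omega

lemma past_le {S Ω : Type*} [MeasurableSpace S] [mΩ : MeasurableSpace Ω]
    {ξ : ℕ → ℕ → ℕ → Ω → S} (hξ : ∀ t k i, Measurable (ξ t k i)) (t k : ℕ) :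
    past ξ t k ≤ mΩ :=
  iSup₂_le fun _ _ => (hξ _ _ _).comap_le

lemma measurable_past_succ {S Ω : Type*} [MeasurableSpace S] (ξ : ℕ → ℕ → ℕ → Ω → S) (t k : ℕ) :
    Measurable[past ξ t (k + 1)] fun ω i => ξ t k i ω := by
  refine @measurable_pi_lambda _ _ _ (past ξ t (k + 1)) _ _ fun i => ?_
  refine Measurable.mono (comap_measurable (ξ t k i)) ?_ le_rfl
  exact le_iSup₂_of_le (f := fun (j : ℕ × ℕ × ℕ) (_ : j ∈ {j : ℕ × ℕ × ℕ | j.1 < t ∨ j.1 = t ∧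
    j.2.1 < k + 1}) => MeasurableSpace.comap (ξ j.1 j.2.1 j.2.2) _) (t, k, i) (by simp) le_rfl

/-- The samples of iteration `k` of run `t` are independent of the earlier ones. -/
lemma indepFun_of_measurable_past {S Ω 𝓧 : Type*} [MeasurableSpace S] [MeasurableSpace Ω]
    [MeasurableSpace 𝓧] {P : Measure Ω} {ξ : ℕ → ℕ → ℕ → Ω → S}
    (hξ : ∀ t k i, Measurable (ξ t k i))
    (hindep : iIndepFun (fun j : ℕ × ℕ × ℕ => ξ j.1 j.2.1 j.2.2) P) {t k : ℕ} {X : Ω → 𝓧}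
    (hX : Measurable[past ξ t k] X) : X ⟂ᵢ[P] fun ω i => ξ t k i ω := by
  have hd : Disjoint {j : ℕ × ℕ × ℕ | j.1 < t ∨ j.1 = t ∧ j.2.1 < k}
      {j | j.1 = t ∧ j.2.1 = k} := by
    rw [Set.disjoint_left]
    rintro j (h : _ ∨ _) (h' : _ ∧ _)
    omega
  have h := indep_iSup_of_disjoint (fun j : ℕ × ℕ × ℕ => (hξ j.1 j.2.1 j.2.2).comap_le) hindep hd
  rw [IndepFun_iff_Indep]
  refine indep_of_indep_of_le_right (indep_of_indep_of_le_left h hX.comap_le) ?_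
  refine Measurable.comap_le (@measurable_pi_lambda _ _ _ (_) _ _ fun i => ?_)
  refine Measurable.mono (comap_measurable (ξ t k i)) ?_ le_rfl
  exact le_iSup₂_of_le (f := fun (j : ℕ × ℕ × ℕ) (_ : j ∈ {j : ℕ × ℕ × ℕ | j.1 = t ∧
    j.2.1 = k}) => MeasurableSpace.comap (ξ j.1 j.2.1 j.2.2) _) (t, k, i) (by simp) le_rfl

section Sampling

variable {n : ℕ} {S Ω : Type*} [MeasurableSpace S]
  {f : EuclideanSpace ℝ (Fin n) → ℝ}
  {G : EuclideanSpace ℝ (Fin n) → S → EuclideanSpace ℝ (Fin n)}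
  {ξ : ℕ → ℕ → ℕ → Ω → S}

lemma measurable_iter_past (hG : Measurable (Function.uncurry G)) (L a B : ℝ) (m : ℕ → ℕ)
    {t : ℕ} {X : Ω → EuclideanSpace ℝ (Fin n)} (hX : Measurable[past ξ t 0] X) (k : ℕ) :
    Measurable[past ξ t k] fun ω => iter G L a B m (fun k i => ξ t k i ω) (X ω) k := by
  induction k with
  | zero => exact hX.prodMk hX
  | succ k ih =>
    exact @measurable_iter_succ _ _ _ _ (past ξ t (k + 1)) _ hG L a B m k _ _
      (measurable_past_succ ξ t k) (ih.mono (past_mono ξ (by omega)) le_rfl)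

lemma measurable_restarted_past (hG : Measurable (Function.uncurry G)) (L a : ℝ) (N₀ : ℕ)
    (B : ℕ → ℝ) (m : ℕ → ℕ → ℕ) (x0 : EuclideanSpace ℝ (Fin n)) (t : ℕ) :
    Measurable[past ξ t 0] fun ω => restarted G L a N₀ B m (fun t k i => ξ t k i ω) x0 t := by
  induction t with
  | zero => exact @measurable_const _ _ _ (_) _
  | succ t ih =>
    have h := measurable_iter_past hG L a (B t) (m t) ih N₀
    exact (measurable_fst.comp h).mono (past_mono ξ (by omega)) le_rfl

lemma measurable_errorSum_past (hf : Measurable (gradient f)) (hG : Measurable (Function.uncurry G))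
    (xstar : EuclideanSpace ℝ (Fin n)) (L a ρ ℓ : ℝ) (m : ℕ → ℕ)
    {t : ℕ} {X : Ω → EuclideanSpace ℝ (Fin n)} (hX : Measurable[past ξ t 0] X) (k : ℕ) :
    Measurable[past ξ t k] fun ω =>
      errorSum f G xstar L a ρ ℓ m (fun k i => ξ t k i ω) (X ω) k := by
  refine @Finset.measurable_sum _ _ _ _ _ _ (past ξ t k) _ _ fun i hi => ?_
  have hi' : i < k := Finset.mem_range.1 hi
  exact @measurable_truncError _ _ _ _ (past ξ t k) _ hf _ hG xstar L a ρ ℓ m i _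
    ((measurable_iter_past hG L a _ m hX i).mono (past_mono ξ (by omega)) le_rfl) _
    ((measurable_past_succ ξ t i).mono (past_mono ξ (by omega)) le_rfl)

/-! ### Concentration -/

variable [MeasurableSpace Ω] {P : Measure Ω} [IsProbabilityMeasure P] {D : Measure S} {σ : ℝ}

/-- The bound is uniform in the frozen state `p`: if a guard fails, the integrand is `1`. Otherwise
the batchsize turns the variance exponent into `41ℓ / (6000N)`, which is below `ℓ / (100N)`. -/
lemma lintegral_exp_truncError_le (hG : IsStochasticGradient f G D σ) {u : ℕ → Ω → S}
    (hu : ∀ i, Measurable (u i)) (hD : ∀ i, P.map (u i) = D) (hindep : iIndepFun u P)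
    (xstar : EuclideanSpace ℝ (Fin n)) {L a ρ ℓ : ℝ} (hL : 0 < L) (ha : 0 < a) (hρ : 0 < ρ)
    (hℓ : 2 ≤ ℓ) {m : ℕ → ℕ} {N k : ℕ} (hN : 0 < N) (hm : 0 < m k)
    (hmk : 6000 * σ ^ 2 * alpha a L (k + 1) ^ 2 * N * ℓ / ρ ^ 2 ≤ m k)
    (p : EuclideanSpace ℝ (Fin n) × EuclideanSpace ℝ (Fin n)) :
    ∫⁻ ω, ENNReal.ofReal (Real.exp (4 * ℓ / ρ ^ 2 *
        truncError f G xstar L a ρ ℓ m k p fun i => u i ω)) ∂P ≤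
      ENNReal.ofReal (Real.exp (ℓ / (100 * N))) := by
  have hα := alpha_succ_pos ha hL k
  have hN' : (0 : ℝ) < N := by exact_mod_cast hN
  have hm' : (0 : ℝ) < m k := by exact_mod_cast hm
  by_cases hp : ‖xstar - p.2‖ ≤ ρ ∧
      ‖gradient f (xPoint a L k p.1 p.2)‖ ≤ ρ / (8 * ℓ) / alpha a L (k + 1) / 2
  · simp only [truncError, if_pos hp]
    obtain ⟨h1, h2, h3, h4⟩ := hG.miniBatch_moments hu hD hindep hm (xPoint a L k p.1 p.2)
    refine (lintegral_exp_stepError_le hα hρ hℓ hp.1 hp.2 h1 h2 h3 h4).trans ?_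
    refine ENNReal.ofReal_le_ofReal (Real.exp_le_exp.2 ?_)
    rw [div_le_iff₀ (by positivity)] at hmk
    have h5 : 41 * ℓ ^ 2 / ρ ^ 2 * (alpha a L (k + 1) ^ 2 * (σ ^ 2 / m k))
        = 41 * ℓ * (6000 * σ ^ 2 * alpha a L (k + 1) ^ 2 * N * ℓ)
          / (6000 * N * (m k * ρ ^ 2)) := by
      field_simp
    rw [h5]
    calc 41 * ℓ * (6000 * σ ^ 2 * alpha a L (k + 1) ^ 2 * N * ℓ) / (6000 * N * (m k * ρ ^ 2))
        ≤ 41 * ℓ * (m k * ρ ^ 2) / (6000 * N * (m k * ρ ^ 2)) := by gcongr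
      _ = 41 / 6000 * (ℓ / N) := by field_simp
      _ ≤ 1 / 100 * (ℓ / N) := mul_le_mul_of_nonneg_right (by norm_num) (by positivity)
      _ = _ := by field_simp
  · simp only [truncError, if_neg hp, mul_zero, Real.exp_zero, lintegral_const, measure_univ,
      mul_one]
    exact ENNReal.ofReal_le_ofReal (Real.one_le_exp (by positivity))

/-- The exponential moments of the accumulated errors. -/
lemma lintegral_exp_errorSum_le (hG : IsStochasticGradient f G D σ) (hf : Measurable (gradient f))
    (hξ : ∀ t k i, Measurable (ξ t k i)) (hD : ∀ t k i, P.map (ξ t k i) = D)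
    (hindep : iIndepFun (fun j : ℕ × ℕ × ℕ => ξ j.1 j.2.1 j.2.2) P)
    (xstar : EuclideanSpace ℝ (Fin n)) {L a ρ ℓ : ℝ} (hL : 0 < L) (ha : 0 < a) (hρ : 0 < ρ)
    (hℓ : 2 ≤ ℓ) {m : ℕ → ℕ} {N : ℕ} (hm : ∀ k < N, 0 < m k)
    (hmk : ∀ k < N, 6000 * σ ^ 2 * alpha a L (k + 1) ^ 2 * N * ℓ / ρ ^ 2 ≤ m k)
    {t : ℕ} {X : Ω → EuclideanSpace ℝ (Fin n)} (hX : Measurable[past ξ t 0] X) (k : ℕ)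
    (hk : k ≤ N) :
    ∫⁻ ω, ENNReal.ofReal (Real.exp (4 * ℓ / ρ ^ 2 *
        errorSum f G xstar L a ρ ℓ m (fun k i => ξ t k i ω) (X ω) k)) ∂P ≤
      ENNReal.ofReal (Real.exp (ℓ / (100 * N))) ^ k := by
  induction k with
  | zero => simp [errorSum]
  | succ k ih =>
    set c := 4 * ℓ / ρ ^ 2 with hc
    -- The next error depends on the past through the state, and it multiplies the exponential of
    -- the running sum. The pair of both is thus the variable to be frozen.
    set Z : Ω → (EuclideanSpace ℝ (Fin n) × EuclideanSpace ℝ (Fin n)) × ℝ := fun ω =>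
      (iter G L a (ρ / (8 * ℓ)) m (fun k i => ξ t k i ω) (X ω) k,
        errorSum f G xstar L a ρ ℓ m (fun k i => ξ t k i ω) (X ω) k) with hZ
    have hZm : Measurable[past ξ t k] Z :=
      (measurable_iter_past hG.measurable L a _ m hX k).prodMk
        (measurable_errorSum_past hf hG.measurable xstar L a ρ ℓ m hX k)
    have hinj : Function.Injective fun i : ℕ => ((t, k, i) : ℕ × ℕ × ℕ) := fun i j h => by
      simpa using h
    have hind : iIndepFun (fun i => ξ t k i) P :=
      iIndepFun.precomp (f := fun j : ℕ × ℕ × ℕ => ξ j.1 j.2.1 j.2.2) hinj hindep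
    have hle := lintegral_exp_truncError_le hG (hξ t k) (hD t k) hind xstar hL ha hρ hℓ
      (by omega) (hm k (by omega)) (hmk k (by omega))
    have hu : Measurable fun z : (EuclideanSpace ℝ (Fin n) × EuclideanSpace ℝ (Fin n)) × ℝ =>
        ENNReal.ofReal (Real.exp (c * z.2)) := by fun_prop
    have ht := measurable_truncError hf hG.measurable xstar L a ρ ℓ m k
      (measurable_fst.fst : Measurable fun q : ((EuclideanSpace ℝ (Fin n) ×
        EuclideanSpace ℝ (Fin n)) × ℝ) × (ℕ → S) => q.1.1) measurable_snd
    have key := lintegral_le_mul_of_indepFun (hZm.mono (past_le hξ t k) le_rfl)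
      (measurable_pi_lambda (fun ω i => ξ t k i ω) fun i => hξ t k i)
      (indepFun_of_measurable_past hξ hindep hZm)
      (h := fun q => ENNReal.ofReal (Real.exp (c * q.1.2)) *
        ENNReal.ofReal (Real.exp (c * truncError f G xstar L a ρ ℓ m k q.1.1 q.2)))
      ((hu.comp measurable_fst).mul (ht.const_mul c).exp.ennreal_ofReal) hu
      (c := ENNReal.ofReal (Real.exp (ℓ / (100 * N)))) (fun z =>
        (lintegral_const_mul' _ _ ENNReal.ofReal_ne_top).trans_le (mul_le_mul_right (hle z.1) _))
    calc ∫⁻ ω, ENNReal.ofReal (Real.exp (c *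
          errorSum f G xstar L a ρ ℓ m (fun k i => ξ t k i ω) (X ω) (k + 1))) ∂P
        = _ := by
          refine lintegral_congr fun ω => ?_
          rw [errorSum, Finset.sum_range_succ, ← errorSum, mul_add, Real.exp_add,
            ENNReal.ofReal_mul (Real.exp_nonneg _)]
      _ ≤ _ := key
      _ ≤ _ := by rw [pow_succ]; gcongr; exact ih (by omega)

/-- With high probability the accumulated errors of a run stay small. -/
lemma measure_exists_errorSum_gt_le (hG : IsStochasticGradient f G D σ)
    (hf : Measurable (gradient f))
    (hξ : ∀ t k i, Measurable (ξ t k i)) (hD : ∀ t k i, P.map (ξ t k i) = D)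
    (hindep : iIndepFun (fun j : ℕ × ℕ × ℕ => ξ j.1 j.2.1 j.2.2) P)
    (xstar : EuclideanSpace ℝ (Fin n)) {L a ρ ℓ : ℝ} (hL : 0 < L) (ha : 0 < a) (hρ : 0 < ρ)
    (hℓ : 2 ≤ ℓ) {m : ℕ → ℕ} {N : ℕ} (hm : ∀ k < N, 0 < m k)
    (hmk : ∀ k < N, 6000 * σ ^ 2 * alpha a L (k + 1) ^ 2 * N * ℓ / ρ ^ 2 ≤ m k)
    {t : ℕ} {X : Ω → EuclideanSpace ℝ (Fin n)} (hX : Measurable[past ξ t 0] X) :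
    P {ω | ∃ k ≤ N, 2 / 5 * ρ ^ 2 <
        errorSum f G xstar L a ρ ℓ m (fun k i => ξ t k i ω) (X ω) k} ≤
      ENNReal.ofReal (N * Real.exp (-ℓ)) := by
  -- The empty sum at `k = 0` cannot exceed the threshold, so only `N` events enter the union bound.
  have hsub : {ω | ∃ k ≤ N, 2 / 5 * ρ ^ 2 <
        errorSum f G xstar L a ρ ℓ m (fun k i => ξ t k i ω) (X ω) k} ⊆
      ⋃ k ∈ Finset.range N, {ω | ENNReal.ofReal (Real.exp (8 / 5 * ℓ)) ≤
        ENNReal.ofReal (Real.exp (4 * ℓ / ρ ^ 2 *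
          errorSum f G xstar L a ρ ℓ m (fun k i => ξ t k i ω) (X ω) (k + 1)))} := by
    rintro ω ⟨k, hk, h⟩
    rcases k with - | k
    · simp only [errorSum, Finset.range_zero, Finset.sum_empty] at h
      linarith [sq_nonneg ρ]
    · simp only [Set.mem_iUnion, Finset.mem_range, Set.mem_ofPred_eq]
      refine ⟨k, by omega, ENNReal.ofReal_le_ofReal (Real.exp_le_exp.2 ?_)⟩
      calc 8 / 5 * ℓ = 4 * ℓ / ρ ^ 2 * (2 / 5 * ρ ^ 2) := by field_simp; norm_num
        _ ≤ _ := by gcongr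
  refine (measure_mono hsub).trans ((measure_biUnion_finset_le _ _).trans ?_)
  have hone : ∀ k ∈ Finset.range N, P {ω | ENNReal.ofReal (Real.exp (8 / 5 * ℓ)) ≤
        ENNReal.ofReal (Real.exp (4 * ℓ / ρ ^ 2 *
          errorSum f G xstar L a ρ ℓ m (fun k i => ξ t k i ω) (X ω) (k + 1)))}
      ≤ ENNReal.ofReal (Real.exp (-ℓ)) := by
    intro k hk
    have hk' : k + 1 ≤ N := Finset.mem_range.1 hk
    have hmeas := ((measurable_errorSum_past hf hG.measurable xstar L a ρ ℓ m hX (k + 1)).mono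
      (past_le hξ t (k + 1)) le_rfl).const_mul (4 * ℓ / ρ ^ 2) |>.exp.ennreal_ofReal
    have hmar := meas_ge_le_lintegral_div (μ := P) hmeas.aemeasurable
      (ε := ENNReal.ofReal (Real.exp (8 / 5 * ℓ))) (by simp [Real.exp_pos]) ENNReal.ofReal_ne_top
    refine hmar.trans ?_
    have hN : (0 : ℝ) < N := by exact_mod_cast (by omega : 0 < N)
    calc _ ≤ ENNReal.ofReal (Real.exp (ℓ / (100 * N))) ^ (k + 1)
          / ENNReal.ofReal (Real.exp (8 / 5 * ℓ)) := by
          gcongr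
          exact lintegral_exp_errorSum_le hG hf hξ hD hindep xstar hL ha hρ hℓ hm hmk hX (k + 1) hk'
      _ = ENNReal.ofReal (Real.exp ((k + 1 : ℕ) * (ℓ / (100 * N)) - 8 / 5 * ℓ)) := by
          rw [← ENNReal.ofReal_pow (Real.exp_nonneg _), ← Real.exp_nat_mul,
            ← ENNReal.ofReal_div_of_pos (Real.exp_pos _), ← Real.exp_sub]
      _ ≤ _ := by
          refine ENNReal.ofReal_le_ofReal (Real.exp_le_exp.2 ?_)
          -- The moments accumulate to at most `ℓ / 100`, and `ℓ / 100 - 8ℓ / 5 ≤ -ℓ`.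
          have : ((k + 1 : ℕ) : ℝ) * (ℓ / (100 * N)) ≤ N * (ℓ / (100 * N)) := by
            gcongr
          have e : N * (ℓ / (100 * N)) = ℓ / 100 := by field_simp
          linarith
  refine (Finset.sum_le_sum hone).trans ?_
  rw [Finset.sum_const, Finset.card_range, nsmul_eq_mul, ENNReal.ofReal_mul (by positivity),
    ENNReal.ofReal_natCast]

end Sampling

/-! ### The number of runs -/

/-- If a factor vanishes, the logarithm is `Real.log 0 = 0`. -/
lemma pos_of_two_le_logFactor {N₀ τ : ℕ} {β : ℝ} (h : 2 ≤ logFactor N₀ τ β) : 0 < N₀ ∧ 0 < τ := by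
  constructor <;>
  · rw [Nat.pos_iff_ne_zero]
    rintro rfl
    norm_num [logFactor] at h

lemma one_lt_of_ceil_logb_pos {x : ℝ} (hx : 0 ≤ x) (h : 0 < ⌈Real.logb 2 x⌉₊) : 1 < x := by
  have h1 : 0 < Real.logb 2 x := Nat.ceil_pos.1 h
  by_contra! h2
  exact absurd (Real.logb_nonpos (b := 2) (by norm_num) hx h2) (by linarith)

lemma le_two_pow_ceil_logb {x : ℝ} (hx : 0 < x) : x ≤ 2 ^ ⌈Real.logb 2 x⌉₊ := by
  have h := Nat.le_ceil (Real.logb 2 x)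
  rw [Real.logb_le_iff_le_rpow (by norm_num) hx, Real.rpow_natCast] at h
  exact h

lemma two_pow_lt_of_lt_ceil_logb {x : ℝ} (hx : 0 < x) {t : ℕ} (ht : t < ⌈Real.logb 2 x⌉₊) :
    (2 : ℝ) ^ t < x := by
  rw [Nat.lt_ceil, Real.lt_logb_iff_rpow_lt (by norm_num) hx, Real.rpow_natCast] at ht
  exact ht

/-- Rounding up costs at most one, that is, a factor `2` inside the logarithm. It later cancels the
`2` in `μR² / (2ε)`. -/
lemma ceil_logb_mul_log_le {x : ℝ} (hx : 1 < x) :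
    ⌈Real.logb 2 x⌉₊ * Real.log 2 ≤ Real.log (2 * x) := by
  have hlog2 : 0 < Real.log 2 := Real.log_pos (by norm_num)
  have h := (Nat.ceil_lt_add_one (Real.logb_pos (b := 2) (by norm_num) hx).le).le
  rw [Real.log_mul (by norm_num) (by linarith)]
  calc _ ≤ (Real.logb 2 x + 1) * Real.log 2 := by gcongr
    _ = _ := by rw [Real.logb]; field_simp; ring

/-! ### The batchsizes -/

lemma batchSize_pos (L σ β R a : ℝ) (N₀ τ t k : ℕ) : 0 < batchSize L σ β R a N₀ τ t k :=
  Nat.ceil_pos.2 (lt_of_lt_of_le one_pos (le_max_left _ _))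

lemma le_batchSize (L σ β R a : ℝ) (N₀ τ t k : ℕ) :
    6000 * 2 ^ t * σ ^ 2 * alpha a L (k + 1) ^ 2 * N₀ * logFactor N₀ τ β / (constC ^ 2 * R ^ 2) ≤
      batchSize L σ β R a N₀ τ t k :=
  ((le_max_left _ _).trans (le_max_right _ _)).trans (Nat.le_ceil _)

lemma sq_constC : constC ^ 2 = 5 := Real.sq_sqrt (by norm_num)

lemma constC_pos : 0 < constC := Real.sqrt_pos.2 (by norm_num)

/-- The radius `√5 R / 2 ^ (t / 2)` of run `t`. -/
noncomputable def runRadius (R : ℝ) (t : ℕ) : ℝ := constC * R / (2 : ℝ) ^ ((t : ℝ) / 2)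

lemma sq_runRadius (R : ℝ) (t : ℕ) : runRadius R t ^ 2 = 5 * R ^ 2 / 2 ^ t := by
  have h : ((2 : ℝ) ^ ((t : ℝ) / 2)) ^ 2 = 2 ^ t := by
    rw [← Real.rpow_natCast, ← Real.rpow_mul (by norm_num), ← Real.rpow_natCast]
    norm_num
  rw [runRadius, div_pow, mul_pow, h, sq_constC]

lemma runRadius_pos {R : ℝ} (hR : 0 < R) (t : ℕ) : 0 < runRadius R t := by
  have := constC_pos
  unfold runRadius
  positivity

lemma clipParam_eq (β R : ℝ) (N₀ τ t : ℕ) :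
    clipParam β R N₀ τ t = runRadius R t / (8 * logFactor N₀ τ β) := by
  rw [clipParam, runRadius, div_div]
  congr 1
  ring

/-! ### Accuracy with high probability -/

/-- The bound after `t` runs equals `μρ_t² / 10`, the input required by `gap_le_of_errorSum_le`. The
output `μρ_t² / 20` is the same bound for `t + 1`. -/
lemma gap_restarted_le {n : ℕ} {S : Type*} {f : EuclideanSpace ℝ (Fin n) → ℝ}
    {G : EuclideanSpace ℝ (Fin n) → S → EuclideanSpace ℝ (Fin n)} {L μ a β R : ℝ}
    (hf : IsLSmooth f L) (hc : IsStronglyConvex f μ) (hL : 0 < L) (hμ : 0 < μ)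
    {x0 xstar : EuclideanSpace ℝ (Fin n)} (hmin : ∀ x, f xstar ≤ f x) (hR : 0 < R)
    (hx0 : f x0 - f xstar ≤ μ * R ^ 2 / 2) {N₀ τ : ℕ} (hN1 : 1 ≤ N₀)
    (hℓ : 2 ≤ logFactor N₀ τ β) (hN : 40 * a * L / μ ≤ (N₀ : ℝ) ^ 2) (ha : aLowerBound β N₀ τ ≤ a)
    {m : ℕ → ℕ → ℕ} {s : ℕ → ℕ → ℕ → S}
    (hsum : ∀ t < τ, ∀ k ≤ N₀, errorSum f G xstar L a (runRadius R t) (logFactor N₀ τ β) (m t) (s t)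
      (restarted G L a N₀ (clipParam β R N₀ τ) m s x0 t) k ≤ 2 / 5 * runRadius R t ^ 2)
    (t : ℕ) (ht : t ≤ τ) :
    f (restarted G L a N₀ (clipParam β R N₀ τ) m s x0 t) - f xstar ≤ μ * R ^ 2 / (2 * 2 ^ t) := by
  induction t with
  | zero => simpa [restarted] using hx0
  | succ t ih =>
    have h := gap_le_of_errorSum_le hf hc hL hμ hmin (runRadius_pos hR t) hℓ
      ((le_max_left _ _).trans ha) (((le_max_right _ _).trans (le_max_right _ _)).trans ha)
      (m := m t) (s := s t)
      (by
        rw [sq_runRadius]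
        refine (ih (by omega)).trans (le_of_eq ?_)
        field_simp
        norm_num) hN1 hN (hsum t (by omega))
    rw [sq_runRadius] at h
    rw [restarted, clipParam_eq]
    refine h.trans (le_of_eq ?_)
    field_simp
    ring

/-- Each run is bad with probability at most `N₀ exp (-ℓ) = β / (4τ)`. The bad events involve
truncated errors, so this holds whether or not earlier runs succeeded, and a plain union bound
suffices. -/
lemma one_sub_le_measureReal_gap_le {n : ℕ} {S Ω : Type*} [MeasurableSpace S] [MeasurableSpace Ω]
    {P : Measure Ω} [IsProbabilityMeasure P] {D : Measure S} {f : EuclideanSpace ℝ (Fin n) → ℝ}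
    {G : EuclideanSpace ℝ (Fin n) → S → EuclideanSpace ℝ (Fin n)} {ξ : ℕ → ℕ → ℕ → Ω → S}
    {x0 xstar : EuclideanSpace ℝ (Fin n)} {L μ σ β R a : ℝ} {N₀ τ : ℕ} (hL : 0 < L) (hμ : 0 < μ)
    (hβ : 0 < β) (hf : IsLSmooth f L) (hc : IsStronglyConvex f μ) (hmin : ∀ x, f xstar ≤ f x)
    (hG : IsStochasticGradient f G D σ) (hξ : ∀ t k i, Measurable (ξ t k i))
    (hD : ∀ t k i, P.map (ξ t k i) = D)
    (hindep : iIndepFun (fun j : ℕ × ℕ × ℕ => ξ j.1 j.2.1 j.2.2) P) (hR : 0 < R)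
    (hx0 : f x0 - f xstar ≤ μ * R ^ 2 / 2) (hℓ : 2 ≤ logFactor N₀ τ β)
    (hN : 40 * a * L / μ ≤ (N₀ : ℝ) ^ 2) (ha : aLowerBound β N₀ τ ≤ a) :
    1 - β ≤ P.real {ω | f (restarted G L a N₀ (clipParam β R N₀ τ) (batchSize L σ β R a N₀ τ)
      (fun t k i => ξ t k i ω) x0 τ) - f xstar ≤ μ * R ^ 2 / (2 * 2 ^ τ)} := by
  obtain ⟨hN0, hτ0⟩ := pos_of_two_le_logFactor hℓ
  have hN0' : (0 : ℝ) < N₀ := by exact_mod_cast hN0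
  have hτ0' : (0 : ℝ) < τ := by exact_mod_cast hτ0
  have ha0 : 0 < a := one_pos.trans_le ((le_max_left _ _).trans ha)
  set ℓ := logFactor N₀ τ β with hℓdef
  set m := batchSize L σ β R a N₀ τ with hm
  set B := clipParam β R N₀ τ with hB
  set bad : ℕ → Set Ω := fun t => {ω | ∃ k ≤ N₀, 2 / 5 * runRadius R t ^ 2 <
    errorSum f G xstar L a (runRadius R t) ℓ (m t) (fun k i => ξ t k i ω)
      (restarted G L a N₀ B m (fun t k i => ξ t k i ω) x0 t) k} with hbad
  have hexp : N₀ * Real.exp (-ℓ) = β / (4 * τ) := by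
    rw [Real.exp_neg, hℓdef, logFactor, Real.exp_log (by positivity)]
    field_simp
  have hPbad : ∀ t, P (bad t) ≤ ENNReal.ofReal (β / (4 * τ)) := fun t => by
    rw [← hexp]
    refine measure_exists_errorSum_gt_le hG (hf.continuous_gradient hL).measurable hξ hD hindep
      xstar hL ha0 (runRadius_pos hR t) hℓ (fun k _ => batchSize_pos L σ β R a N₀ τ t k)
      (fun k _ => ?_) (measurable_restarted_past hG.measurable L a N₀ B m x0 t)
    refine le_trans (le_of_eq ?_) (le_batchSize L σ β R a N₀ τ t k)
    rw [sq_runRadius, sq_constC, ← hℓdef]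
    field_simp
  have hPunion : P.real (⋃ t ∈ Finset.range τ, bad t) ≤ β := by
    refine ENNReal.toReal_le_of_le_ofReal hβ.le ?_
    calc P (⋃ t ∈ Finset.range τ, bad t) ≤ ∑ t ∈ Finset.range τ, P (bad t) :=
          measure_biUnion_finset_le _ _
      _ ≤ ∑ t ∈ Finset.range τ, ENNReal.ofReal (β / (4 * τ)) :=
          Finset.sum_le_sum fun t _ => hPbad t
      _ = ENNReal.ofReal (τ * (β / (4 * τ))) := by
          rw [Finset.sum_const, Finset.card_range, nsmul_eq_mul, ENNReal.ofReal_mul hτ0'.le,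
            ENNReal.ofReal_natCast]
      _ ≤ ENNReal.ofReal β := by
          refine ENNReal.ofReal_le_ofReal ?_
          have : τ * (β / (4 * τ)) = β / 4 := by field_simp
          linarith
  set good := {ω | f (restarted G L a N₀ B m (fun t k i => ξ t k i ω) x0 τ) - f xstar
    ≤ μ * R ^ 2 / (2 * 2 ^ τ)} with hgood
  have hcover : Set.univ ⊆ good ∪ ⋃ t ∈ Finset.range τ, bad t := by
    intro ω _
    by_cases h : ω ∈ ⋃ t ∈ Finset.range τ, bad t
    · exact Or.inr h
    · refine Or.inl (gap_restarted_le hf hc hL hμ hmin hR hx0 hN0 hℓ hN ha (fun t ht k hk => ?_)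
        τ le_rfl)
      by_contra! hlt
      exact h (Set.mem_biUnion (Finset.mem_coe.2 (Finset.mem_range.2 ht)) ⟨k, hk, hlt⟩)
  -- Covering the whole space and using subadditivity makes measurability of `good` unnecessary.
  have h1 : P.real Set.univ ≤ P.real good + P.real (⋃ t ∈ Finset.range τ, bad t) :=
    (measureReal_mono hcover).trans (measureReal_union_le _ _)
  rw [probReal_univ] at h1
  linarith

/-! ### Complexity -/

/-- If `exp x ≤ q x`, then `x ≤ 2 log q`. -/
lemma le_two_mul_log_of_exp_le {x q : ℝ} (hx : 0 < x) (hq : 0 < q)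
    (h : Real.exp x ≤ q * x) : x ≤ 2 * Real.log q := by
  -- Replacing the factor `x` by `exp (x / 2)` leaves `exp (x / 2) ≤ q`.
  have h1 : x ≤ Real.exp (x / 2) := by
    have := Real.quadratic_le_exp_of_nonneg (x := x / 2) (by positivity)
    nlinarith [sq_nonneg (x / 2 - 1)]
  have h2 : Real.exp (x / 2) ≤ q := by
    have h3 : Real.exp (x / 2) * Real.exp (x / 2) ≤ q * Real.exp (x / 2) := by
      rw [← Real.exp_add, add_halves]
      exact h.trans (by gcongr)
    exact le_of_mul_le_mul_right h3 (Real.exp_pos _)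
  have h3 := (Real.le_log_iff_exp_le hq).2 h2
  linarith

/-- A self-bounding inequality for the number of iterations. -/
lemma mul_le_of_le_mul_log {N τ β d X c : ℝ} (hN : 0 < N) (hτ : 0 < τ) (hβ : 0 < β)
    (hd : 0 < d) (hX : 0 < X) (hc : 0 < c) (hΛ : 0 < Real.log (N * τ / β))
    (hNd : N ≤ c * d * Real.log (N * τ / β)) (hτX : τ ≤ X / Real.log 2) :
    N * τ ≤ c / Real.log 2 * (2 * |Real.log (c / Real.log 2)| + 2) *
      (d * X * max 1 (Real.log (d / β * X))) := by
  have hlog2 : 0 < Real.log 2 := Real.log_pos (by norm_num)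
  set Λ := Real.log (N * τ / β) with hΛdef
  set c' := c / Real.log 2 with hc'
  have hc'0 : 0 < c' := by positivity
  have h1 : N * τ ≤ c' * (d * X) * Λ := by
    calc N * τ ≤ c * d * Λ * (X / Real.log 2) := by gcongr
      _ = _ := by rw [hc']; ring
  have h2 : Real.exp Λ ≤ c' * (d / β * X) * Λ := by
    rw [hΛdef, Real.exp_log (by positivity), ← hΛdef, div_le_iff₀ hβ]
    refine h1.trans (le_of_eq ?_)
    field_simp
  have h3 := le_two_mul_log_of_exp_le hΛ (by positivity) h2
  rw [Real.log_mul hc'0.ne' (by positivity)] at h3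
  set M := max 1 (Real.log (d / β * X)) with hM
  have hM1 : 1 ≤ M := le_max_left _ _
  have hM2 : Real.log (d / β * X) ≤ M := le_max_right _ _
  -- Since `M ≥ 1`, the additive constant `2 log c'` is absorbed into a multiple of `M`.
  have h4 : Λ ≤ (2 * |Real.log c'| + 2) * M := by
    have h5 := le_abs_self (Real.log c')
    have h6 : |Real.log c'| ≤ |Real.log c'| * M := le_mul_of_one_le_right (abs_nonneg _) hM1
    linarith
  calc N * τ ≤ c' * (d * X) * Λ := h1
    _ ≤ c' * (d * X) * ((2 * |Real.log c'| + 2) * M) := by gcongr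
    _ = _ := by ring

lemma log_four_lt : Real.log 4 < 1.4 := by
  have h : Real.log 4 = 2 * Real.log 2 := by
    rw [show (4 : ℝ) = 2 ^ 2 by norm_num, Real.log_pow]; norm_num
  rw [h]
  linarith [Real.log_two_lt_d9]

/-- Together with `ℓ ≥ 2` and `log 4 < 1.4` this gives `Λ > 0.6`. Hence `Λ > 0` and `ℓ ≤ 4Λ`, which
makes the two logarithms comparable. -/
lemma logFactor_eq {N₀ τ : ℕ} {β : ℝ} (hβ : 0 < β) (hN : 0 < N₀) (hτ : 0 < τ) :
    logFactor N₀ τ β = Real.log 4 + Real.log (N₀ * τ / β) := by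
  have hN' : (0 : ℝ) < N₀ := by exact_mod_cast hN
  have hτ' : (0 : ℝ) < τ := by exact_mod_cast hτ
  rw [logFactor, ← Real.log_mul (by norm_num) (by positivity)]
  congr 1
  ring

/-- With `q = √(aL / μ)`, the bounds `2^t < μR² / (2ε)`, `α ≤ N₀ / (aL)` and `N₀ ≤ c₄ q` reduce the
main term to a multiple of `σ²Λ / (qμε)`. The lower bound on `a` says exactly that this ratio is at
most `1 / √c₁`. -/
lemma batchSize_le {L μ σ ε β R a c₁ c₄ Λ : ℝ} {N₀ τ t k : ℕ} (hL : 0 < L) (hμ : 0 < μ)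
    (hε : 0 < ε) (hR : 0 < R) (ha : 0 < a) (hσ : 0 < σ) (hc₁ : 0 < c₁) (hc₄ : 0 < c₄) (hΛ : 0 < Λ)
    (hN : 0 < N₀) (hℓ : 2 ≤ logFactor N₀ τ β) (hℓΛ : logFactor N₀ τ β ≤ 4 * Λ)
    (ha₁ : c₁ * (σ ^ 4 * Λ ^ 2 / (L * μ * ε ^ 2)) ≤ a) (hN₄ : N₀ ≤ c₄ * √(a * L / μ))
    (ht : (2 : ℝ) ^ t < μ * R ^ 2 / (2 * ε)) (hk : k < N₀) :
    (batchSize L σ β R a N₀ τ t k : ℝ) ≤ 2 + 2400 * c₄ ^ 3 / √c₁ := by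
  have hN' : (0 : ℝ) < N₀ := by exact_mod_cast hN
  set ℓ := logFactor N₀ τ β with hℓdef
  set q := √(a * L / μ) with hq
  have hq0 : 0 < q := Real.sqrt_pos.2 (by positivity)
  have hq2 : q ^ 2 = a * L / μ := Real.sq_sqrt (by positivity)
  have hα0 := alpha_succ_pos ha hL k
  have hα : alpha a L (k + 1) ≤ N₀ / (a * L) := by
    have h1 : (k : ℝ) + 1 ≤ N₀ := by exact_mod_cast hk
    have h2 : (1 : ℝ) ≤ N₀ := by exact_mod_cast hN
    rw [alpha_succ, div_le_div_iff₀ (by positivity) (by positivity)]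
    have : ((k : ℝ) + 2) * (a * L) ≤ (2 * N₀) * (a * L) := by gcongr; linarith
    linarith
  have hq1 : √c₁ * (σ ^ 2 * Λ) ≤ q * (μ * ε) := by
    refine abs_le_of_sq_le_sq' ?_ (by positivity) |>.2
    rw [mul_pow, mul_pow q, Real.sq_sqrt hc₁.le, hq2]
    rw [← mul_div_assoc, div_le_iff₀ (by positivity)] at ha₁
    calc c₁ * (σ ^ 2 * Λ) ^ 2 = c₁ * (σ ^ 4 * Λ ^ 2) := by ring
      _ ≤ a * (L * μ * ε ^ 2) := ha₁
      _ = _ := by field_simp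
  have hmain : 6000 * 2 ^ t * σ ^ 2 * alpha a L (k + 1) ^ 2 * N₀ * ℓ / (constC ^ 2 * R ^ 2)
      ≤ 2400 * c₄ ^ 3 / √c₁ := by
    have hs : 0 < √c₁ := Real.sqrt_pos.2 hc₁
    rw [sq_constC]
    calc 6000 * 2 ^ t * σ ^ 2 * alpha a L (k + 1) ^ 2 * N₀ * ℓ / (5 * R ^ 2)
        ≤ 6000 * (μ * R ^ 2 / (2 * ε)) * σ ^ 2 * (N₀ / (a * L)) ^ 2 * N₀ * (4 * Λ) / (5 * R ^ 2) := by
          gcongr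
      _ = 2400 * μ * σ ^ 2 * Λ * N₀ ^ 3 / (ε * (a * L) ^ 2) := by field_simp; norm_num
      _ ≤ 2400 * μ * σ ^ 2 * Λ * (c₄ * q) ^ 3 / (ε * (a * L) ^ 2) := by gcongr
      _ = 2400 * c₄ ^ 3 * (σ ^ 2 * Λ) / (q * (μ * ε)) := by
          have : a * L = q ^ 2 * μ := by rw [hq2]; field_simp
          rw [this]
          field_simp
      _ ≤ 2400 * c₄ ^ 3 / √c₁ := by
          rw [div_le_div_iff₀ (by positivity) hs]
          calc 2400 * c₄ ^ 3 * (σ ^ 2 * Λ) * √c₁ = 2400 * c₄ ^ 3 * (√c₁ * (σ ^ 2 * Λ)) := by ring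
            _ ≤ _ := by gcongr
  -- As `ℓ ≥ 2`, the second batchsize term is dominated by the first: `10368 ≤ 6000ℓ`.
  have hsecond : 10368 * 2 ^ t * σ ^ 2 * alpha a L (k + 1) ^ 2 * N₀ / (constC ^ 2 * R ^ 2)
      ≤ 2400 * c₄ ^ 3 / √c₁ := by
    refine le_trans ?_ hmain
    gcongr ?_ / _
    calc 10368 * 2 ^ t * σ ^ 2 * alpha a L (k + 1) ^ 2 * N₀
        = 2 ^ t * σ ^ 2 * alpha a L (k + 1) ^ 2 * N₀ * 10368 := by ring
      _ ≤ 2 ^ t * σ ^ 2 * alpha a L (k + 1) ^ 2 * N₀ * (6000 * ℓ) := by gcongr; linarith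
      _ = _ := by ring
  have hK : 0 ≤ 2400 * c₄ ^ 3 / √c₁ := by positivity
  refine (Nat.ceil_lt_add_one (zero_le_one.trans (le_max_left _ _))).le.trans ?_
  have := max_le (a := (1 : ℝ)) (by linarith : 1 ≤ 1 + 2400 * c₄ ^ 3 / √c₁)
    (max_le (hmain.trans (by linarith)) (hsecond.trans (by linarith)))
  linarith

end ClippedSSTM

/-! ### Assembly of the main theorem -/

theorem mainTheorem5 (c₁ c₂ c₃ c₄ : ℝ) (hc₁ : 0 < c₁) (hc₂ : 0 < c₂) (hc₃ : 0 < c₃)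
    (hc₄ : 0 < c₄) :
    ∃ K : ℝ, 0 < K ∧
      ∀ (n : ℕ) (S Ω : Type*) [MeasurableSpace S] [MeasurableSpace Ω]
        (P : Measure Ω) [IsProbabilityMeasure P] (D : Measure S)
        (f : EuclideanSpace ℝ (Fin n) → ℝ)
        (G : EuclideanSpace ℝ (Fin n) → S → EuclideanSpace ℝ (Fin n))
        (ξ : ℕ → ℕ → ℕ → Ω → S)
        (x0 xstar : EuclideanSpace ℝ (Fin n))
        (L μ σ ε β R a : ℝ) (N₀ τ : ℕ),
        -- the problem
        0 < L → 0 < μ → 0 ≤ σ → 0 < ε → 0 < β → β < 1 →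
        ClippedSSTM.IsLSmooth f L → ClippedSSTM.IsStronglyConvex f μ →
        (∀ x, f xstar ≤ f x) →
        -- the stochastic gradients and the i.i.d. samples
        ClippedSSTM.IsStochasticGradient f G D σ →
        (∀ t k i, Measurable (ξ t k i)) → (∀ t k i, P.map (ξ t k i) = D) →
        iIndepFun (fun j : ℕ × ℕ × ℕ => ξ j.1 j.2.1 j.2.2) P →
        -- the parameters
        R = √(2 * (f x0 - f xstar) / μ) →
        τ = ⌈Real.logb 2 (μ * R ^ 2 / (2 * ε))⌉₊ →
        1 ≤ N₀ →
        2 ≤ ClippedSSTM.logFactor N₀ τ β →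
        ClippedSSTM.constC * √(8 * a * L / μ) ≤ N₀ →
        ClippedSSTM.aLowerBound β N₀ τ ≤ a →
        c₁ * (σ ^ 4 * Real.log (N₀ * τ / β) ^ 2 / (L * μ * ε ^ 2)) ≤ a →
        a ≤ c₂ * (σ ^ 4 * Real.log (N₀ * τ / β) ^ 2 / (L * μ * ε ^ 2)) →
        c₃ * √(a * L / μ) ≤ N₀ →
        N₀ ≤ c₄ * √(a * L / μ) →
        -- accuracy with high probability, total number of iterations, batchsizes
        1 - β ≤ P.real {ω | f (ClippedSSTM.restarted G L a N₀ (ClippedSSTM.clipParam β R N₀ τ)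
            (ClippedSSTM.batchSize L σ β R a N₀ τ) (fun t k i => ξ t k i ω) x0 τ)
              - f xstar ≤ ε} ∧
        (N₀ : ℝ) * τ ≤ K * (σ ^ 2 / (μ * ε) * Real.log (μ * R ^ 2 / ε) *
            max 1 (Real.log (σ ^ 2 / (μ * ε * β) * Real.log (μ * R ^ 2 / ε)))) ∧
        ∀ t < τ, ∀ k < N₀, (ClippedSSTM.batchSize L σ β R a N₀ τ t k : ℝ) ≤ K := by
  have hlog2 : 0 < Real.log 2 := Real.log_pos (by norm_num)
  have hs₂ : 0 < √c₂ := Real.sqrt_pos.2 hc₂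
  set c := c₄ * √c₂ with hc
  have hc0 : 0 < c := by positivity
  -- The first entry bounds the iteration count, where `c` is the constant in `N₀ ≤ c · σ²Λ / (με)`;
  -- the second bounds the batchsizes.
  refine ⟨max (c / Real.log 2 * (2 * |Real.log (c / Real.log 2)| + 2))
    (2 + 2400 * c₄ ^ 3 / √c₁), lt_max_of_lt_right (by positivity), ?_⟩
  intro n S Ω _ _ P _ D f G ξ x0 xstar L μ σ ε β R a N₀ τ hL hμ hσ hε hβ hβ1 hf hcv hmin hG hξ hD
    hindep hR hτ hN₀ hℓ hN hab ha₁ ha₂ _ hN₄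
  obtain ⟨-, hτ0⟩ := ClippedSSTM.pos_of_two_le_logFactor hℓ
  have ha0 : 0 < a := one_pos.trans_le ((le_max_left _ _).trans hab)
  -- Without noise the upper bound on `a` would force `a ≤ 0`.
  have hσ0 : 0 < σ := by
    refine hσ.lt_of_ne fun h => ?_
    rw [← h] at ha₂
    norm_num at ha₂
    linarith
  have hN' : (0 : ℝ) < N₀ := by exact_mod_cast hN₀
  have hτ' : (0 : ℝ) < τ := by exact_mod_cast hτ0
  have hR0 : 0 ≤ R := hR ▸ Real.sqrt_nonneg _
  -- At least one run takes place, so the initial bound `μR² / 2` exceeds `ε`; in particular `R >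
  -- 0`.
  have hx : 1 < μ * R ^ 2 / (2 * ε) :=
    ClippedSSTM.one_lt_of_ceil_logb_pos (by positivity) (hτ ▸ hτ0)
  have hRpos : 0 < R := by
    refine hR0.lt_of_ne fun h => ?_
    rw [← h] at hx
    norm_num at hx
  have hR2 : f x0 - f xstar ≤ μ * R ^ 2 / 2 := by
    have h0 : 0 ≤ f x0 - f xstar := by linarith [hmin x0]
    rw [hR, Real.sq_sqrt (by positivity)]
    refine le_of_eq ?_
    field_simp
  have hℓeq := ClippedSSTM.logFactor_eq hβ hN₀ hτ0
  have hlog4 := ClippedSSTM.log_four_lt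
  set Λ := Real.log (N₀ * τ / β) with hΛdef
  have hΛ : 0 < Λ := by linarith
  refine ⟨?_, ?_, ?_⟩
  · have hN40 : 40 * a * L / μ ≤ (N₀ : ℝ) ^ 2 := by
      have h := pow_le_pow_left₀ (mul_nonneg ClippedSSTM.constC_pos.le (Real.sqrt_nonneg _)) hN 2
      rw [mul_pow, ClippedSSTM.sq_constC, Real.sq_sqrt (by positivity)] at h
      refine le_trans (le_of_eq ?_) h
      ring
    refine (ClippedSSTM.one_sub_le_measureReal_gap_le hL hμ hβ hf hcv hmin hG hξ hD hindep hRpos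
      hR2 hℓ hN40 hab).trans (measureReal_mono (Set.ofPred_subset_ofPred.2 fun ω hω => hω.trans ?_))
    have h := ClippedSSTM.le_two_pow_ceil_logb (zero_lt_one.trans hx)
    rw [← hτ, div_le_iff₀ (by positivity)] at h
    rw [div_le_iff₀ (by positivity)]
    linarith
  · have hX : 2 * (μ * R ^ 2 / (2 * ε)) = μ * R ^ 2 / ε := by field_simp
    have hτX : (τ : ℝ) ≤ Real.log (μ * R ^ 2 / ε) / Real.log 2 := by
      rw [le_div_iff₀ hlog2, hτ, ← hX]
      exact ClippedSSTM.ceil_logb_mul_log_le hx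
    have hXpos : 0 < Real.log (μ * R ^ 2 / ε) := Real.log_pos (by linarith)
    have hNd : (N₀ : ℝ) ≤ c * (σ ^ 2 / (μ * ε)) * Λ := by
      have h1 : √(a * L / μ) ≤ √c₂ * (σ ^ 2 / (μ * ε) * Λ) := by
        refine Real.sqrt_le_iff.2 ⟨by positivity, ?_⟩
        rw [mul_pow, Real.sq_sqrt hc₂.le]
        calc a * L / μ ≤ c₂ * (σ ^ 4 * Λ ^ 2 / (L * μ * ε ^ 2)) * L / μ := by gcongr
          _ = _ := by field_simp
      calc (N₀ : ℝ) ≤ c₄ * √(a * L / μ) := hN₄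
        _ ≤ c₄ * (√c₂ * (σ ^ 2 / (μ * ε) * Λ)) := by gcongr
        _ = _ := by rw [hc]; ring
    have h := ClippedSSTM.mul_le_of_le_mul_log hN' hτ' hβ (by positivity) hXpos hc0 hΛ hNd hτX
    rw [div_div (σ ^ 2)] at h
    refine h.trans ?_
    gcongr
    exact le_max_left _ _
  · intro t ht k hk
    refine (ClippedSSTM.batchSize_le hL hμ hε hRpos ha0 hσ0 hc₁ hc₄ hΛ hN₀ hℓ (by linarith) ha₁ hN₄
      (ClippedSSTM.two_pow_lt_of_lt_ceil_logb (zero_lt_one.trans hx) (hτ ▸ ht)) hk).trans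
        (le_max_right _ _)
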